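/- **Setting.** Let $s\ge 1$ and $p,q\ge 0$ be integers, $d,\omega,\theta,\gamma\in\mathbb R$, and let $\alpha(z)=\sum_{i=0}^{p}(-\alpha_i)z^i$, $\beta(z)=\sum_{j=0}^{q}(-\beta_j)z^j$ be real polynomials with $\alpha_0=\beta_0=-1$, without common roots, and with $\beta(z)\ne 0$ for $|z|\le 1$. Let $\lambda(z):=\frac{\alpha(z)}{\beta(z)}(1-z^s)^{-d}=\sum_{k\ge 0}\lambda_{d,k}z^k$ for $|z|<1$ (principal branch; the closed formula also defines $\lambda(z)$ for $|z|=1$, $z^s\neq1$). Let $\{Z_t\}_{t\in\mathbb Z}$ be i.i.d. real random variables with mean $0$ and variance $1$, and put $g(Z_t)=\theta Z_t+\gamma\,(|Z_t|-\mathbb E|Z_t|)$. Let $\{X_t\}_{t\in\mathbb Z}$ be the SFIEGARCH$(p,d,q)_s$ process, i.e. $X_t=\sigma_tZ_t$ with $\sigma_t>0$ and $$\ln(\sigma_t^2)=\omega+\sum_{k=0}^{\infty}\lambda_{d,k}\,g(Z_{t-1-k}),\qquad t\in\mathbb Z,$$ where the series converges almost surely. A function $f\ge 0$, integrable on $(-\pi,\pi]$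 and even there, is called a spectral density of a weakly stationary real process $\{Y_t\}_{t\in\mathbb Z}$ if $\mathrm{Cov}(Y_t,Y_{t+h})=\int_{(-\pi,\pi]}e^{ihu}f(u)\,du$ for all $t,h\in\mathbb Z$. **Theorem.** Assume $d<1/2$, that $\theta$ and $\gamma$ are not both zero, that $\alpha(z)\neq 0$ for $|z|\le 1$, and that $\ln(Z_t^2)$ is almost surely finite (that is, $Z_t\ne 0$ a.s.) with $\sigma^2_{\ln Z^2}:=\mathrm{Var}(\ln(Z_t^2))<\infty$. Put $\sigma_g^2=\mathrm{Var}(g(Z_0))$, $C_1=\mathrm{Cov}\big(g(Z_0),\ln(Z_0^2)\big)$ and $\Lambda(u)=\lambda(e^{-iu})$. Then the processes $\{\ln(\sigma_t^2)\}$, $\{\ln(Z_t^2)\}$ and $\{\ln(X_t^2)\}$ are weakly stationary, they have the spectral densities $$f_{\ln\sigma^2}(u)=\frac{\sigma_g^2}{2\pi}\,\frac{|\alpha(e^{-iu})|^2}{|\beta(e^{-iu})|^2}\,\big|1-e^{-isu}\big|^{-2d},\qquad f_{\ln Z^2}(u)=\frac{\sigma^2_{\ln Z^2}}{2\pi},$$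 $$f_{\ln X^2}(u)=f_{\ln\sigma^2}(u)+\frac{C_1}{\pi}\,\Re\big(e^{-iu}\Lambda(u)\big)+f_{\ln Z^2}(u),$$ respectively, for $u\in(-\pi,\pi]$. (If $d>0$, the finitely many $u$ with $e^{-isu}=1$, at which these expressions have poles, are excepted; there the factors $|1-e^{-isu}|^{-2d}$ and $(1-e^{-isu})^{-d}$ are given the value $0$, which does not matter for a density.) -/

import Mathlib

open MeasureTheory ProbabilityTheory Filter Topology

noncomputable section

namespace SFIEGARCH

/-- The real polynomial `∑_{i=0}^{n} (-a_i) z^i`. -/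
def lagPoly (n : ℕ) (a : ℕ → ℝ) : Polynomial ℝ :=
  ∑ i ∈ Finset.range (n + 1), Polynomial.monomial i (-a i)

/-- The coefficient of `y^j` in the Maclaurin series of `(1 - y)^{-d}`, that is
`d (d+1) ⋯ (d+j-1) / j!`.  It equals `Γ(j+d) / (Γ(j+1) Γ(d))` whenever `d` is not a pole of the
Gamma function (see `fracCoeff_eq_Gamma`), and is the continuous extension in `d` otherwise. -/
def fracCoeff (d : ℝ) (j : ℕ) : ℝ :=
  (ascPochhammer ℝ j).eval d / (j.factorial : ℝ)

theorem fracCoeff_eq_Gamma (d : ℝ) (hd : ∀ m : ℕ, d ≠ -(m : ℝ)) (j : ℕ) :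
    fracCoeff d j = Real.Gamma (j + d) / (Real.Gamma (j + 1) * Real.Gamma d) := by
  have hG : Real.Gamma d ≠ 0 := Real.Gamma_ne_zero hd
  have key : Real.Gamma (j + d) = (ascPochhammer ℝ j).eval d * Real.Gamma d := by
    induction j with
    | zero => simp
    | succ j ih =>
      have hne : (j : ℝ) + d ≠ 0 := fun h => hd j (by linarith)
      have h1 : ((j + 1 : ℕ) : ℝ) + d = (j + d) + 1 := by push_cast; ring
      rw [h1, Real.Gamma_add_one hne, ih, ascPochhammer_succ_eval]
      ring
  rw [fracCoeff, key, Real.Gamma_nat_eq_factorial]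
  have : (j.factorial : ℝ) ≠ 0 := by positivity
  field_simp

/-- The Maclaurin series of `(1 - z^s)^{-d}`: the coefficient `π_{d,k}` of `z^k` vanishes unless
`s ∣ k`, and `π_{d,sj}` is the `j`-th coefficient of `(1 - y)^{-d}`. -/
def seasonalSeries (d : ℝ) (s : ℕ) : PowerSeries ℝ :=
  PowerSeries.mk fun k => if s ∣ k then fracCoeff d (k / s) else 0

/-- The coefficients `λ_{d,k}` of `λ(z) = α(z) / β(z) · (1 - z^s)^{-d} = ∑_k λ_{d,k} z^k`. -/
def lamCoeff (α β : Polynomial ℝ) (d : ℝ) (s : ℕ) (k : ℕ) : ℝ :=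
  PowerSeries.coeff k ((α : PowerSeries ℝ) * (β : PowerSeries ℝ)⁻¹ * seasonalSeries d s)

/-- The function `λ(z) = α(z) / β(z) · (1 - z^s)^{-d}` of a complex variable, with the principal
branch of the power (for `|z| ≤ 1` the real part of `1 - z^s` is nonnegative). -/
def lamFun (α β : Polynomial ℝ) (d : ℝ) (s : ℕ) (z : ℂ) : ℂ :=
  Polynomial.aeval z α / Polynomial.aeval z β * (1 - z ^ s) ^ (-(d : ℂ))

section Model

variable {Ω : Type*} [MeasurableSpace Ω]

/-- The process `g(Z_t) = θ Z_t + γ (|Z_t| - E|Z_t|)`. -/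
def gProc (P : Measure Ω) (θ γ : ℝ) (Z : ℤ → Ω → ℝ) (t : ℤ) (x : Ω) : ℝ :=
  θ * Z t x + γ * (|Z t x| - ∫ y, |Z t y| ∂P)

/-- `{X_t}` is an SFIEGARCH`(p,d,q)_s` process with innovations `{Z_t}` and volatility `{σ_t}`,
where `α(z) = ∑_{i ≤ p} (-a_i) z^i` and `β(z) = ∑_{j ≤ q} (-b_j) z^j`. -/
structure IsSFIEGARCH (P : Measure Ω) (p q : ℕ) (a b : ℕ → ℝ) (d : ℝ) (s : ℕ) (ω θ γ : ℝ)
    (Z σ X : ℤ → Ω → ℝ) : Prop where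
  period_pos : 1 ≤ s
  alpha_zero : a 0 = -1
  beta_zero : b 0 = -1
  no_common_root : ∀ z : ℂ, ¬ (Polynomial.aeval z (lagPoly p a) = 0 ∧
    Polynomial.aeval z (lagPoly q b) = 0)
  beta_ne_zero : ∀ z : ℂ, ‖z‖ ≤ 1 → Polynomial.aeval z (lagPoly q b) ≠ 0
  innov_measurable : ∀ t, Measurable (Z t)
  innov_indep : iIndepFun Z P
  innov_identDistrib : ∀ t, IdentDistrib (Z t) (Z 0) P P
  innov_memLp : ∀ t, MemLp (Z t) 2 P
  innov_mean : ∀ t, ∫ x, Z t x ∂P = 0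
  innov_var : ∀ t, Var[Z t; P] = 1
  vol_pos : ∀ t, ∀ᵐ x ∂P, 0 < σ t x
  /-- `ln(σ_t²) = ω + ∑_{k ≥ 0} λ_{d,k} g(Z_{t-1-k})`, the series converging almost surely. -/
  log_vol : ∀ t, ∀ᵐ x ∂P, Tendsto
    (fun n : ℕ => ω + ∑ k ∈ Finset.range n,
      lamCoeff (lagPoly p a) (lagPoly q b) d s k * gProc P θ γ Z (t - 1 - (k : ℤ)) x)
    atTop (𝓝 (Real.log (σ t x ^ 2)))
  eq_mul : ∀ t, ∀ᵐ x ∂P, X t x = σ t x * Z t x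

/-- Weak stationarity of a real-valued process indexed by `ℤ`. -/
structure IsWeaklyStationary (P : Measure Ω) (Y : ℤ → Ω → ℝ) : Prop where
  memLp : ∀ t, MemLp (Y t) 2 P
  mean_eq : ∀ t, ∫ x, Y t x ∂P = ∫ x, Y 0 x ∂P
  cov_eq : ∀ t h, cov[Y t, Y (t + h); P] = cov[Y 0, Y h; P]

/-- `f` is a spectral density of the weakly stationary real process `{Y_t}`: it is nonnegative and
integrable on `(-π, π]`, even there, and
`γ_Y(h) = ∫_{(-π,π]} e^{ihu} f(u) du` for every lag `h`. -/
structure IsSpectralDensity (P : Measure Ω) (Y : ℤ → Ω → ℝ) (f : ℝ → ℝ) : Prop where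
  stationary : IsWeaklyStationary P Y
  nonneg : ∀ u ∈ Set.Ioc (-Real.pi) Real.pi, 0 ≤ f u
  even : ∀ u ∈ Set.Ioo (-Real.pi) Real.pi, f (-u) = f u
  integrableOn : IntegrableOn f (Set.Ioc (-Real.pi) Real.pi)
  autocov_eq : ∀ h : ℤ, ((cov[Y 0, Y h; P] : ℝ) : ℂ) =
    ∫ u in Set.Ioc (-Real.pi) Real.pi, Complex.exp (Complex.I * (h : ℂ) * (u : ℂ)) * (f u : ℂ)

/-- The variance `σ_g²` of `g(Z_0)`. -/
def gVar (P : Measure Ω) (θ γ : ℝ) (Z : ℤ → Ω → ℝ) : ℝ := Var[gProc P θ γ Z 0; P]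

/-- The constant `C₁ = Cov(g(Z_0), ln(Z_0²))`. -/
def covConst (P : Measure Ω) (θ γ : ℝ) (Z : ℤ → Ω → ℝ) : ℝ :=
  cov[gProc P θ γ Z 0, fun x => Real.log (Z 0 x ^ 2); P]

/-- `f_{ln σ²}(u) = σ_g² / (2π) · |α(e^{-iu})|² / |β(e^{-iu})|² · |1 - e^{-isu}|^{-2d}`. -/
def specLogVol (α β : Polynomial ℝ) (d : ℝ) (s : ℕ) (vg : ℝ) (u : ℝ) : ℝ :=
  vg / (2 * Real.pi) *
    (‖Polynomial.aeval (Complex.exp (-(Complex.I * (u : ℂ)))) α‖ ^ 2 /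
      ‖Polynomial.aeval (Complex.exp (-(Complex.I * (u : ℂ)))) β‖ ^ 2) *
    ‖1 - Complex.exp (-(Complex.I * (s : ℂ) * (u : ℂ)))‖ ^ (-(2 * d))

/-- `Λ(u) = λ(e^{-iu})`. -/
def transfer (α β : Polynomial ℝ) (d : ℝ) (s : ℕ) (u : ℝ) : ℂ :=
  lamFun α β d s (Complex.exp (-(Complex.I * (u : ℂ))))

/-- `f_{ln Z²}(u) = σ²_{ln Z²} / (2π)`. -/
def specLogInnov (P : Measure Ω) (Z : ℤ → Ω → ℝ) (_u : ℝ) : ℝ :=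
  Var[fun x => Real.log (Z 0 x ^ 2); P] / (2 * Real.pi)

end Model

end SFIEGARCH

end

/-! The log-volatility is a causal linear filter of the white noise `g(Z_t)` with transfer function
`Λ`, and everything reduces to Fourier analysis of `Λ` on the circle.

Analytic side. On `|u| ≤ π` the quotient `α/β` is bounded, so `|Λ|²` is dominated by a multiple of
`|1 - e^{-isu}|^{-2d}`, which is integrable because `d < 1/2`. The Fourier coefficients of `Λ` are
the `λ_{d,k}`: this is clear on circles of radius `r < 1`, where the power series converges
absolutely, and it survives `r → 1` by dominated convergence (`integral_exp_mul_transfer`). Parseval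
for `Λ` and `e^{ihu} Λ` then shows that `∑ λ_k²` is finite and that `∑ λ_k λ_{k+h}` is a Fourier
coefficient of `|Λ|²` (`hasSum_lamCoeffInt_mul`).

Probabilistic side. The `g(Z_t)` are centred and orthogonal in `L²`, so square summability upgrades
the almost sure convergence of the defining series to `L²` convergence, and covariances with `ln
σ_t²` may be taken term by term (`tendsto_covariance_of_ae_tendsto`). This gives `σ_g² ∑ λ_k
λ_{k+h}` for `ln σ²` and, against `ln Z_u²`, the single term `λ_{t-1-u} C₁`. Since `ln X² = ln σ² +
ln Z²`, the two cross terms at lag `h` are `C₁ (λ_{h-1} + λ_{-h-1})`, the Fourier coefficients of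
`(C₁/π) Re(e^{-iu} Λ)`.

Nonnegativity of the last density is pointwise: with `w = e^{-iu} Λ(u)`, `2π f` is at least the
variance of `Re(w) g(Z_0) + ln Z_0²`. -/

noncomputable section

namespace SFIEGARCH

/-! ### Power series expansion of `λ` in the unit disc -/

/-- `F` is the sum, in the open unit disc, of the absolutely convergent power series `φ`. -/
def HasDiscExpansion (φ : PowerSeries ℂ) (F : ℂ → ℂ) : Prop :=
  ∀ z : ℂ, ‖z‖ < 1 → Summable (fun k => ‖PowerSeries.coeff k φ * z ^ k‖) ∧
    ∑' k, PowerSeries.coeff k φ * z ^ k = F z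

theorem HasDiscExpansion.hasSum {φ : PowerSeries ℂ} {F : ℂ → ℂ} (h : HasDiscExpansion φ F)
    {z : ℂ} (hz : ‖z‖ < 1) : HasSum (fun k => PowerSeries.coeff k φ * z ^ k) (F z) := by
  rw [← (h z hz).2]
  exact (h z hz).1.of_norm.hasSum

theorem HasDiscExpansion.congr {φ : PowerSeries ℂ} {F G : ℂ → ℂ} (h : HasDiscExpansion φ F)
    (hFG : ∀ z : ℂ, ‖z‖ < 1 → F z = G z) : HasDiscExpansion φ G := fun z hz =>
  ⟨(h z hz).1, (h z hz).2.trans (hFG z hz)⟩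

theorem HasDiscExpansion.mul {φ ψ : PowerSeries ℂ} {F G : ℂ → ℂ} (hφ : HasDiscExpansion φ F)
    (hψ : HasDiscExpansion ψ G) : HasDiscExpansion (φ * ψ) (fun z => F z * G z) := by
  intro z hz
  have h1 := summable_norm_sum_mul_antidiagonal_of_summable_norm (hφ z hz).1 (hψ z hz).1
  have h2 := tsum_mul_tsum_eq_tsum_sum_antidiagonal_of_summable_norm (hφ z hz).1 (hψ z hz).1
  have key : ∀ k, PowerSeries.coeff k (φ * ψ) * z ^ k =
      ∑ kl ∈ Finset.HasAntidiagonal.antidiagonal k,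
        (PowerSeries.coeff kl.1 φ * z ^ kl.1) * (PowerSeries.coeff kl.2 ψ * z ^ kl.2) := by
    intro k
    rw [PowerSeries.coeff_mul, Finset.sum_mul]
    refine Finset.sum_congr rfl fun kl hkl => ?_
    have : kl.1 + kl.2 = k := by simpa using hkl
    rw [← this, pow_add]
    ring
  simp_rw [← key] at h1 h2
  rw [(hφ z hz).2, (hψ z hz).2] at h2
  exact ⟨h1, h2.symm⟩

theorem HasDiscExpansion.of_hasFPowerSeriesOnBall {F : ℂ → ℂ}
    {p : FormalMultilinearSeries ℂ ℂ ℂ} (h : HasFPowerSeriesOnBall F p 0 1) :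
    HasDiscExpansion (PowerSeries.mk p.coeff) F := by
  intro z hz
  have hz' : z ∈ Metric.eball (0 : ℂ) 1 := by
    rwa [Metric.mem_eball, edist_zero_right, ← ofReal_norm, ENNReal.ofReal_lt_one]
  have h1 : ∀ k, PowerSeries.coeff k (PowerSeries.mk p.coeff) * z ^ k = p k fun _ => z := by
    intro k
    rw [PowerSeries.coeff_mk, FormalMultilinearSeries.apply_eq_pow_smul_coeff, smul_eq_mul, mul_comm]
  simp only [h1]
  refine ⟨p.summable_norm_apply (Metric.eball_subset_eball h.r_le hz'), ?_⟩
  simpa using (h.hasSum hz').tsum_eq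

theorem HasDiscExpansion.hasFPowerSeriesOnBall {φ : PowerSeries ℂ} {F : ℂ → ℂ}
    (h : HasDiscExpansion φ F) :
    HasFPowerSeriesOnBall F
      (FormalMultilinearSeries.ofScalars ℂ fun k => PowerSeries.coeff k φ) 0 1 := by
  refine ⟨?_, one_pos, ?_⟩
  · refine ENNReal.le_of_forall_nnreal_lt fun r hr => ?_
    refine FormalMultilinearSeries.le_radius_of_summable_norm _ ?_
    have hr' : ‖((r : ℝ) : ℂ)‖ < 1 := by simpa using hr
    refine (h _ hr').1.congr fun k => ?_
    rw [FormalMultilinearSeries.ofScalars_norm, norm_mul, norm_pow, Complex.norm_real,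
      NNReal.norm_eq]
  · intro z hz
    have hz' : ‖z‖ < 1 := by
      rwa [Metric.mem_eball, edist_zero_right, ← ofReal_norm, ENNReal.ofReal_lt_one] at hz
    have := h.hasSum hz'
    rw [zero_add]
    simpa only [FormalMultilinearSeries.ofScalars_apply_eq, smul_eq_mul] using this

theorem HasDiscExpansion.unique {φ ψ : PowerSeries ℂ} {F : ℂ → ℂ} (hφ : HasDiscExpansion φ F)
    (hψ : HasDiscExpansion ψ F) : φ = ψ := by
  have h := hφ.hasFPowerSeriesOnBall.hasFPowerSeriesAt.eq_formalMultilinearSeries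
    hψ.hasFPowerSeriesOnBall.hasFPowerSeriesAt
  have h2 := FormalMultilinearSeries.ofScalars_series_injective ℂ ℂ h
  ext k
  exact congrFun h2 k

theorem hasDiscExpansion_polynomial (f : Polynomial ℝ) :
    HasDiscExpansion (PowerSeries.map (algebraMap ℝ ℂ) (f : PowerSeries ℝ))
      (fun z => Polynomial.aeval z f) := by
  intro z _
  have h0 : ∀ k ∉ Finset.range (f.natDegree + 1),
      PowerSeries.coeff k (PowerSeries.map (algebraMap ℝ ℂ) (f : PowerSeries ℝ)) * z ^ k = 0 := by
    intro k hk
    have : f.coeff k = 0 := Polynomial.coeff_eq_zero_of_natDegree_lt (by simpa using hk)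
    simp [this]
  refine ⟨summable_of_ne_finset_zero (s := Finset.range (f.natDegree + 1))
    fun k hk => by rw [h0 k hk, norm_zero], ?_⟩
  rw [tsum_eq_sum h0]
  show _ = Polynomial.aeval z f
  rw [Polynomial.aeval_eq_sum_range]
  refine Finset.sum_congr rfl fun k _ => ?_
  simp

/-- The analytic function `1/f` has some expansion in the disc. Its product with `f` expands the
constant 1, so by uniqueness of expansions it is a formal inverse of `f`, and formal inverses are
unique. -/
theorem hasDiscExpansion_inv (f : Polynomial ℝ)
    (hf : ∀ z : ℂ, ‖z‖ ≤ 1 → Polynomial.aeval z f ≠ 0) :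
    HasDiscExpansion (PowerSeries.map (algebraMap ℝ ℂ) ((f : PowerSeries ℝ)⁻¹))
      (fun z => (Polynomial.aeval z f)⁻¹) := by
  have hd : DifferentiableOn ℂ (fun z : ℂ => (Polynomial.aeval z f)⁻¹)
      (Metric.closedBall 0 ((1 : NNReal) : ℝ)) := by
    intro z hz
    refine DifferentiableAt.differentiableWithinAt ?_
    exact (Polynomial.differentiable_aeval f z).inv (hf z (by simpa using hz))
  have h1 := HasDiscExpansion.of_hasFPowerSeriesOnBall (F := fun z : ℂ => (Polynomial.aeval z f)⁻¹)
    (by simpa using hd.hasFPowerSeriesOnBall one_pos)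
  have h2 := (hasDiscExpansion_polynomial f).mul h1
  have h3 : HasDiscExpansion (1 : PowerSeries ℂ)
      (fun z => Polynomial.aeval z f * (Polynomial.aeval z f)⁻¹) := by
    have h := hasDiscExpansion_polynomial 1
    simp only [Polynomial.coe_one, map_one] at h
    exact h.congr fun z hz => (mul_inv_cancel₀ (hf z hz.le)).symm
  have h4 := h2.unique h3
  have hc : PowerSeries.constantCoeff (f : PowerSeries ℝ) ≠ 0 := by
    have h0 := hf 0 (by simp)
    intro h
    apply h0
    have : f.coeff 0 = 0 := by simpa using h
    simp [Polynomial.aeval_def, Polynomial.eval₂_at_zero, this]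
  have h5 : PowerSeries.map (algebraMap ℝ ℂ) (f : PowerSeries ℝ) *
      PowerSeries.map (algebraMap ℝ ℂ) ((f : PowerSeries ℝ)⁻¹) = 1 := by
    rw [← map_mul, PowerSeries.mul_inv_cancel _ hc, map_one]
  rw [← (left_inv_eq_right_inv (by rw [mul_comm]; exact h4) h5)]
  exact h1

theorem choose_eq_fracCoeff (d : ℝ) (j : ℕ) :
    Ring.choose ((d : ℂ) + j - 1) j = (fracCoeff d j : ℂ) := by
  have h : Ring.choose ((d : ℂ) + j - 1) j = ((Ring.choose (d + j - 1) j : ℝ) : ℂ) := by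
    rw [Complex.ofReal_choose]; push_cast; rfl
  rw [h, ← Ring.multichoose_eq, fracCoeff]
  congr 1
  have h2 := Ring.factorial_nsmul_multichoose_eq_ascPochhammer d j
  rw [Polynomial.ascPochhammer_smeval_eq_eval, nsmul_eq_mul] at h2
  rw [eq_div_iff (by positivity), mul_comm, h2]

/-- The binomial series of `(1 - y)^{-d}` is evaluated at `y = z^s`. The terms are supported on
multiples of `s`, so sums reindex along the injection `j ↦ s j`. -/
theorem hasDiscExpansion_seasonal (d : ℝ) {s : ℕ} (hs : 1 ≤ s) :
    HasDiscExpansion (PowerSeries.map (algebraMap ℝ ℂ) (seasonalSeries d s))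
      (fun z => (1 - z ^ s) ^ (-(d : ℂ))) := by
  have h1 := HasDiscExpansion.of_hasFPowerSeriesOnBall
    (Complex.one_div_one_sub_cpow_hasFPowerSeriesOnBall_zero d)
  intro z hz
  have hz' : ‖z ^ s‖ < 1 := by
    rw [norm_pow]; exact pow_lt_one₀ (norm_nonneg _) hz (by omega)
  obtain ⟨h2, h3⟩ := h1 _ hz'
  have hinj : Function.Injective fun j : ℕ => s * j := fun i j h =>
    Nat.eq_of_mul_eq_mul_left (by omega) h
  set u : ℕ → ℂ := fun k =>
    PowerSeries.coeff k (PowerSeries.map (algebraMap ℝ ℂ) (seasonalSeries d s)) * z ^ k with hu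
  have hzero : ∀ k ∉ Set.range (fun j : ℕ => s * j), u k = 0 := by
    intro k hk
    have : ¬ s ∣ k := fun ⟨j, hj⟩ => hk ⟨j, hj.symm⟩
    simp [hu, seasonalSeries, this]
  have hcomp : ∀ j, u (s * j) = PowerSeries.coeff j (PowerSeries.mk
      (FormalMultilinearSeries.ofScalars ℂ fun n : ℕ =>
        Ring.choose ((d : ℂ) + n - 1) n).coeff) * (z ^ s) ^ j := by
    intro j
    have : s * j / s = j := Nat.mul_div_cancel_left _ (by omega)
    simp [hu, seasonalSeries, this, FormalMultilinearSeries.coeff_ofScalars, choose_eq_fracCoeff,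
      pow_mul]
  refine ⟨?_, ?_⟩
  · rw [← hinj.summable_iff (f := fun k => ‖u k‖) (fun k hk => by
      show ‖u k‖ = 0
      rw [hzero k hk, norm_zero])]
    refine h2.congr fun j => ?_
    rw [Function.comp_apply, hcomp]
  · rw [← hinj.tsum_eq (f := u) (fun k hk => by
      by_contra h
      exact hk (hzero k h))]
    simp only [hcomp]
    rw [h3, Complex.cpow_neg, ← one_div]

theorem hasSum_lamFun {α β : Polynomial ℝ} (d : ℝ) {s : ℕ} (hs : 1 ≤ s)
    (hβ : ∀ z : ℂ, ‖z‖ ≤ 1 → Polynomial.aeval z β ≠ 0) {z : ℂ} (hz : ‖z‖ < 1) :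
    HasSum (fun k => (lamCoeff α β d s k : ℂ) * z ^ k) (lamFun α β d s z) := by
  have h := (((hasDiscExpansion_polynomial α).mul (hasDiscExpansion_inv β hβ)).mul
    (hasDiscExpansion_seasonal d hs)).hasSum hz
  rw [← map_mul, ← map_mul] at h
  exact h

/-! ### Size and integrability of the transfer function on the circle -/

/-- Both parts of `1 - w = (1 - r w) + (r w - w)` are at most `|1 - r w|` in norm. The bound keeps
the singularity under control uniformly in the radius `r`. -/
theorem norm_one_sub_le_two_mul {w : ℂ} (hw : ‖w‖ = 1) {r : ℝ} (h0 : 0 ≤ r) (h1 : r ≤ 1) :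
    ‖1 - w‖ ≤ 2 * ‖1 - r * w‖ := by
  have e1 : ‖(r : ℂ) * w‖ = r := by simp [hw, abs_of_nonneg h0]
  have e2 : 1 - r ≤ ‖1 - r * w‖ := by
    have := norm_sub_norm_le (1 : ℂ) (r * w)
    rwa [e1, norm_one] at this
  have e3 : ‖(r : ℂ) * w - w‖ = 1 - r := by
    rw [← sub_one_mul, norm_mul, hw, mul_one, ← Complex.ofReal_one, ← Complex.ofReal_sub,
      Complex.norm_real, Real.norm_eq_abs, abs_of_nonpos (by linarith)]
    ring
  have e4 := norm_add_le (1 - (r : ℂ) * w) (r * w - w)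
  rw [sub_add_sub_cancel, e3] at e4
  linarith

theorem norm_exp_neg_I_mul (x : ℝ) : ‖Complex.exp (-(Complex.I * (x : ℂ)))‖ = 1 := by
  rw [show -(Complex.I * (x : ℂ)) = ((-x : ℝ) : ℂ) * Complex.I by push_cast; ring]
  exact Complex.norm_exp_ofReal_mul_I _

theorem norm_exp_I_mul_int_mul (k : ℤ) (x : ℝ) :
    ‖Complex.exp (Complex.I * (k : ℂ) * (x : ℂ))‖ = 1 := by
  rw [show Complex.I * (k : ℂ) * (x : ℂ) = ((k * x : ℝ) : ℂ) * Complex.I by push_cast; ring]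
  exact Complex.norm_exp_ofReal_mul_I _

theorem norm_one_sub_exp_neg_I_mul (x : ℝ) :
    ‖1 - Complex.exp (-(Complex.I * (x : ℂ)))‖ = 2 * |Real.sin (x / 2)| := by
  have h := Complex.norm_exp_I_mul_ofReal_sub_one (-x)
  rw [norm_sub_rev, show -(Complex.I * (x : ℂ)) = Complex.I * ((-x : ℝ) : ℂ) by push_cast; ring, h,
    neg_div, Real.sin_neg, mul_neg, norm_neg, norm_mul]
  simp

theorem norm_one_sub_le_two {w : ℂ} (hw : ‖w‖ ≤ 1) : ‖1 - w‖ ≤ 2 := by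
  have := norm_sub_le (1 : ℂ) w
  rw [norm_one] at this
  linarith

/-- On `(0, π]` the base equals `2 sin(x/2)` and lies between `2x/π` and `2`. Evenness and
periodicity then give every interval, as needed for the substitution `x = s u`. -/
theorem intervalIntegrable_rpow_norm_one_sub_exp {e : ℝ} (he : -1 < e) (a b : ℝ) :
    IntervalIntegrable (fun x : ℝ => ‖1 - Complex.exp (-(Complex.I * (x : ℂ)))‖ ^ e) volume a b := by
  have hmeas : Measurable (fun x : ℝ => ‖1 - Complex.exp (-(Complex.I * (x : ℂ)))‖ ^ e) := by
    fun_prop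
  have hper : Function.Periodic (fun x : ℝ => ‖1 - Complex.exp (-(Complex.I * (x : ℂ)))‖ ^ e)
      (2 * Real.pi) := by
    intro x
    have : -(Complex.I * ((x + 2 * Real.pi : ℝ) : ℂ)) =
        -(Complex.I * (x : ℂ)) - 2 * Real.pi * Complex.I := by push_cast; ring
    simp only [this, Complex.exp_periodic.sub_eq]
  have heven : ∀ x : ℝ, ‖1 - Complex.exp (-(Complex.I * ((-x : ℝ) : ℂ)))‖ ^ e =
      ‖1 - Complex.exp (-(Complex.I * (x : ℂ)))‖ ^ e := by
    intro x
    simp only [norm_one_sub_exp_neg_I_mul, neg_div, Real.sin_neg, abs_neg]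
  have hpos : IntervalIntegrable (fun x : ℝ => ‖1 - Complex.exp (-(Complex.I * (x : ℂ)))‖ ^ e)
      volume 0 Real.pi := by
    -- The first summand dominates when `e ≥ 0`, the second when `e ≤ 0`; adding them treats both
    -- signs at once.
    have hb : IntervalIntegrable (fun x : ℝ => 2 ^ e + (2 / Real.pi) ^ e * x ^ e) volume 0 Real.pi :=
      intervalIntegrable_const.add ((intervalIntegral.intervalIntegrable_rpow' he).const_mul _)
    refine hb.mono_fun' hmeas.aestronglyMeasurable ?_
    rw [Set.uIoc_of_le Real.pi_pos.le]
    filter_upwards [ae_restrict_mem measurableSet_Ioc] with x hx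
    have hx0 : 0 < x := hx.1
    rw [Real.norm_of_nonneg (by positivity), ← Real.mul_rpow (by positivity) hx0.le]
    have hlow : 2 / Real.pi * x ≤ ‖1 - Complex.exp (-(Complex.I * (x : ℂ)))‖ := by
      rw [norm_one_sub_exp_neg_I_mul]
      have h := Real.mul_abs_le_abs_sin (x := x / 2) (by
        rw [abs_of_pos (by linarith)]; linarith [hx.2])
      rw [abs_of_pos (by linarith : 0 < x / 2)] at h
      linarith
    have hlow0 : 0 < 2 / Real.pi * x := by have := Real.pi_pos; positivity
    have hup := norm_one_sub_le_two (norm_exp_neg_I_mul x).le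
    rcases le_total 0 e with h0 | h0
    · have := Real.rpow_le_rpow (norm_nonneg _) hup h0
      have h2 : 0 ≤ (2 / Real.pi * x) ^ e := by positivity
      linarith
    · have := Real.rpow_le_rpow_of_nonpos hlow0 hlow h0
      have h2 : (0 : ℝ) ≤ 2 ^ e := by positivity
      linarith
  have hneg : IntervalIntegrable (fun x : ℝ => ‖1 - Complex.exp (-(Complex.I * (x : ℂ)))‖ ^ e)
      volume (-Real.pi) 0 := by
    have h := (IntervalIntegrable.iff_comp_neg (by simp)).mp hpos
    simp only [heven, neg_zero] at h
    exact h.symm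
  refine hper.intervalIntegrable (by positivity) (t := -Real.pi) ?_ a b
  rw [show -Real.pi + 2 * Real.pi = Real.pi by ring]
  exact hneg.trans hpos

theorem integrableOn_rpow_norm_one_sub_exp {e : ℝ} (he : -1 < e) {s : ℕ} (hs : 1 ≤ s) :
    IntegrableOn (fun u : ℝ => ‖1 - Complex.exp (-(Complex.I * (s : ℂ) * (u : ℂ)))‖ ^ e)
      (Set.Ioc (-Real.pi) Real.pi) := by
  have hs0 : (s : ℝ) ≠ 0 := by positivity
  have h := (intervalIntegrable_rpow_norm_one_sub_exp he (s * -Real.pi) (s * Real.pi)).comp_mul_left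
    (c := s)
  rw [mul_div_cancel_left₀ _ hs0, mul_div_cancel_left₀ _ hs0] at h
  rw [← intervalIntegrable_iff_integrableOn_Ioc_of_le (by linarith [Real.pi_pos])]
  refine h.congr fun u _ => ?_
  push_cast
  simp only [mul_assoc]

theorem exp_neg_I_mul_pow (s : ℕ) (u : ℝ) :
    Complex.exp (-(Complex.I * (u : ℂ))) ^ s = Complex.exp (-(Complex.I * (s : ℂ) * (u : ℂ))) := by
  rw [← Complex.exp_nat_mul]
  congr 1
  ring

theorem norm_exp_neg_I_mul_mul (s : ℕ) (u : ℝ) :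
    ‖Complex.exp (-(Complex.I * (s : ℂ) * (u : ℂ)))‖ = 1 := by
  rw [← exp_neg_I_mul_pow, norm_pow, norm_exp_neg_I_mul, one_pow]

theorem exists_norm_aeval_div_le (α : Polynomial ℝ) {β : Polynomial ℝ}
    (hβ : ∀ z : ℂ, ‖z‖ ≤ 1 → Polynomial.aeval z β ≠ 0) :
    ∃ C : ℝ, 0 ≤ C ∧ ∀ z : ℂ, ‖z‖ ≤ 1 →
      ‖(Polynomial.aeval z α : ℂ) / Polynomial.aeval z β‖ ≤ C := by
  have hc : ContinuousOn (fun z : ℂ => (Polynomial.aeval z α : ℂ) / Polynomial.aeval z β)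
      (Metric.closedBall 0 1) :=
    (Polynomial.continuous_aeval α).continuousOn.div (Polynomial.continuous_aeval β).continuousOn
      fun z hz => hβ z (by simpa using hz)
  obtain ⟨C, hC⟩ := (isCompact_closedBall (0 : ℂ) 1).exists_bound_of_continuousOn hc
  refine ⟨C, (norm_nonneg _).trans (hC 0 (by simp)), fun z hz => hC z (by simpa using hz)⟩

theorem norm_transfer (α β : Polynomial ℝ) (d : ℝ) (s : ℕ) (u : ℝ) :
    ‖transfer α β d s u‖ =
      ‖(Polynomial.aeval (Complex.exp (-(Complex.I * (u : ℂ)))) α : ℂ) /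
        Polynomial.aeval (Complex.exp (-(Complex.I * (u : ℂ)))) β‖ *
      ‖1 - Complex.exp (-(Complex.I * (s : ℂ) * (u : ℂ)))‖ ^ (-d) := by
  rw [transfer, lamFun, norm_mul, exp_neg_I_mul_pow, ← Complex.ofReal_neg, Complex.norm_cpow_real]

theorem specLogVol_eq (α β : Polynomial ℝ) (d : ℝ) (s : ℕ) (v : ℝ) (u : ℝ) :
    specLogVol α β d s v u = v / (2 * Real.pi) * ‖transfer α β d s u‖ ^ 2 := by
  rw [norm_transfer, specLogVol, mul_pow, norm_div, div_pow, mul_assoc, ← Real.rpow_mul_natCast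
    (norm_nonneg _)]
  push_cast
  rw [show -(2 * d) = -d * 2 by ring]

theorem measurable_lamFun_circle (α β : Polynomial ℝ) (d : ℝ) (s : ℕ) (r : ℝ) :
    Measurable fun u : ℝ => lamFun α β d s (r * Complex.exp (-(Complex.I * (u : ℂ)))) := by
  have h1 : Measurable fun z : ℂ => lamFun α β d s z := by
    unfold lamFun
    refine Measurable.mul (Measurable.div ?_ ?_) ?_
    · exact (Polynomial.continuous_aeval α).measurable
    · exact (Polynomial.continuous_aeval β).measurable
    · fun_prop
  exact h1.comp (by fun_prop)

theorem measurable_transfer (α β : Polynomial ℝ) (d : ℝ) (s : ℕ) :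
    Measurable (transfer α β d s) := by
  have := measurable_lamFun_circle α β d s 1
  simp only [Complex.ofReal_one, one_mul] at this
  exact this

/-- The exponent of `|1 - e^{-isu}|` in `|Λ|²` is `-2d`, and `-2d > -1` is exactly `d < 1/2`. -/
theorem memLp_transfer (α : Polynomial ℝ) {β : Polynomial ℝ} {d : ℝ} {s : ℕ} (hs : 1 ≤ s)
    (hβ : ∀ z : ℂ, ‖z‖ ≤ 1 → Polynomial.aeval z β ≠ 0) (hd : d < 1 / 2) :
    MemLp (transfer α β d s) 2 (volume.restrict (Set.Ioc (-Real.pi) Real.pi)) := by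
  rw [memLp_two_iff_integrable_sq_norm (measurable_transfer α β d s).aestronglyMeasurable]
  obtain ⟨C, hC0, hC⟩ := exists_norm_aeval_div_le α hβ
  have h := (integrableOn_rpow_norm_one_sub_exp (e := -d * 2) (by linarith) hs).const_mul (C ^ 2)
  refine Integrable.mono' h ((measurable_transfer α β d s).norm.pow_const 2).aestronglyMeasurable ?_
  refine ae_of_all _ fun u => ?_
  rw [Real.norm_of_nonneg (by positivity), norm_transfer, mul_pow, ← Real.rpow_mul_natCast
    (norm_nonneg _)]
  push_cast
  gcongr
  exact hC _ (norm_exp_neg_I_mul u).le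

/-! ### Fourier coefficients of the transfer function -/

/-- The coefficients `λ_{d,k}`, extended by zero to `k < 0`. -/
def lamCoeffInt (α β : Polynomial ℝ) (d : ℝ) (s : ℕ) (k : ℤ) : ℝ :=
  if 0 ≤ k then lamCoeff α β d s k.toNat else 0

@[simp]
theorem lamCoeffInt_natCast (α β : Polynomial ℝ) (d : ℝ) (s : ℕ) (k : ℕ) :
    lamCoeffInt α β d s k = lamCoeff α β d s k := by
  simp [lamCoeffInt]

theorem lamCoeffInt_of_neg (α β : Polynomial ℝ) (d : ℝ) (s : ℕ) {k : ℤ} (hk : k < 0) :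
    lamCoeffInt α β d s k = 0 := by
  simp [lamCoeffInt, hk]

theorem integral_exp_I_mul_int_mul (m : ℤ) :
    ∫ u in Set.Ioc (-Real.pi) Real.pi, Complex.exp (Complex.I * (m : ℂ) * (u : ℂ)) =
      if m = 0 then 2 * (Real.pi : ℂ) else 0 := by
  rw [← intervalIntegral.integral_of_le (by linarith [Real.pi_pos])]
  split_ifs with hm
  · simp [hm]
    ring
  · have hc : Complex.I * (m : ℂ) ≠ 0 := by simp [hm]
    rw [integral_exp_mul_complex hc, div_eq_zero_iff]
    left
    rw [show Complex.I * (m : ℂ) * (Real.pi : ℝ) = Complex.I * m * ((-Real.pi : ℝ) : ℂ) +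
      m * (2 * Real.pi * Complex.I) by push_cast; ring, Complex.exp_add,
      Complex.exp_int_mul_two_pi_mul_I, mul_one, sub_self]

theorem integrableOn_of_norm_eq_one {f : ℝ → ℂ} (hf : Measurable f) (h : ∀ u, ‖f u‖ = 1) :
    IntegrableOn f (Set.Ioc (-Real.pi) Real.pi) :=
  Integrable.of_bound hf.aestronglyMeasurable 1 (ae_of_all _ fun u => (h u).le)

/-- For `r < 1` the series converges absolutely and uniformly on the circle, so it is integrated
termwise; orthogonality of exponentials leaves at most the term `n = k`, and none for `k < 0`. -/
theorem integral_exp_mul_lamFun {α β : Polynomial ℝ} (d : ℝ) {s : ℕ} (hs : 1 ≤ s)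
    (hβ : ∀ z : ℂ, ‖z‖ ≤ 1 → Polynomial.aeval z β ≠ 0) {r : ℝ} (h0 : 0 ≤ r) (h1 : r < 1) (k : ℤ) :
    ∫ u in Set.Ioc (-Real.pi) Real.pi, Complex.exp (Complex.I * (k : ℂ) * (u : ℂ)) *
      lamFun α β d s (r * Complex.exp (-(Complex.I * (u : ℂ)))) =
    2 * Real.pi * (lamCoeffInt α β d s k : ℂ) * (r : ℂ) ^ k.toNat := by
  have hr : ‖(r : ℂ)‖ < 1 := by simpa [abs_of_nonneg h0] using h1
  set F : ℕ → ℝ → ℂ := fun n u => ((lamCoeff α β d s n : ℂ) * (r : ℂ) ^ n) *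
    Complex.exp (Complex.I * ((k - n : ℤ) : ℂ) * (u : ℂ)) with hF
  have hexp : ∀ (n : ℕ) (u : ℝ), Complex.exp (Complex.I * (k : ℂ) * (u : ℂ)) *
      ((lamCoeff α β d s n : ℂ) * (r * Complex.exp (-(Complex.I * (u : ℂ)))) ^ n) = F n u := by
    intro n u
    have : Complex.exp (Complex.I * ((k - n : ℤ) : ℂ) * (u : ℂ)) =
        Complex.exp (Complex.I * (k : ℂ) * (u : ℂ)) *
          Complex.exp (-(Complex.I * (u : ℂ))) ^ n := by
      rw [← Complex.exp_nat_mul, ← Complex.exp_add]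
      congr 1
      push_cast
      ring
    rw [hF]
    simp only [this, mul_pow]
    ring
  have hFi : ∀ n, Integrable (F n) (volume.restrict (Set.Ioc (-Real.pi) Real.pi)) := fun n =>
    (integrableOn_of_norm_eq_one (by fun_prop) fun u => norm_exp_I_mul_int_mul _ u).const_mul _
  have hnorm : ∀ n u, ‖F n u‖ = ‖(lamCoeff α β d s n : ℂ) * (r : ℂ) ^ n‖ := by
    intro n u
    rw [hF]
    simp only [norm_mul, norm_exp_I_mul_int_mul, mul_one]
  have hsum : Summable fun n => ‖(lamCoeff α β d s n : ℂ) * (r : ℂ) ^ n‖ :=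
    (hasSum_lamFun (α := α) d hs hβ hr).summable.norm
  have hs1 := hasSum_integral_of_summable_integral_norm hFi (by
    simp only [hnorm, integral_const]
    exact hsum.const_smul _)
  have hpt : ∀ u : ℝ, ∑' n, F n u = Complex.exp (Complex.I * (k : ℂ) * (u : ℂ)) *
      lamFun α β d s (r * Complex.exp (-(Complex.I * (u : ℂ)))) := by
    intro u
    have hz : ‖(r : ℂ) * Complex.exp (-(Complex.I * (u : ℂ)))‖ < 1 := by
      rwa [norm_mul, norm_exp_neg_I_mul, mul_one]
    have h := (hasSum_lamFun (α := α) d hs hβ hz).mul_left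
      (Complex.exp (Complex.I * (k : ℂ) * (u : ℂ)))
    simp only [hexp] at h
    exact h.tsum_eq
  simp only [hpt] at hs1
  refine hs1.unique ?_
  have hint : ∀ n : ℕ, ∫ u in Set.Ioc (-Real.pi) Real.pi, F n u =
      if (n : ℤ) = k then ((lamCoeff α β d s n : ℂ) * (r : ℂ) ^ n) * (2 * Real.pi) else 0 := by
    intro n
    rw [hF]
    simp only [integral_const_mul, integral_exp_I_mul_int_mul]
    by_cases h : (n : ℤ) = k
    · simp [h]
    · have h2 : ¬ (k - (n : ℤ) = 0) := by omega
      simp only [h, h2, if_false, mul_zero]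
  simp only [hint]
  rcases le_or_gt 0 k with hk | hk
  · lift k to ℕ using hk
    simp only [Nat.cast_inj, lamCoeffInt_natCast, Int.toNat_natCast]
    have h2 : ∀ n : ℕ, (if n = k then
        ((lamCoeff α β d s n : ℂ) * (r : ℂ) ^ n) * (2 * (Real.pi : ℂ)) else 0) =
        if n = k then 2 * Real.pi * (lamCoeff α β d s k : ℂ) * (r : ℂ) ^ k else 0 := by
      intro n
      split_ifs with h
      · rw [h]
        ring
      · rfl
    simp only [h2]
    exact hasSum_ite_eq k _
  · rw [lamCoeffInt_of_neg _ _ _ _ hk]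
    have : ∀ n : ℕ, ¬ (n : ℤ) = k := fun n => by omega
    simp only [this, if_false, Complex.ofReal_zero, mul_zero, zero_mul]
    exact hasSum_zero

/-- Keeps `1 - z^s` off the branch cut of the principal power, even on the boundary circle away from
`z^s = 1`. -/
theorem one_sub_re_pos {w : ℂ} (hw : ‖w‖ ≤ 1) (h1 : w ≠ 1) : 0 < (1 - w).re := by
  have hre := (Complex.re_le_norm w).trans hw
  rw [Complex.sub_re, Complex.one_re, sub_pos]
  refine lt_of_le_of_ne hre fun h => h1 ?_
  have h2 : ‖w‖ ^ 2 ≤ 1 := pow_le_one₀ (norm_nonneg _) hw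
  rw [Complex.sq_norm, Complex.normSq_apply, h] at h2
  refine Complex.ext h ?_
  rw [Complex.one_im]
  nlinarith

theorem ae_exp_neg_I_mul_mul_ne_one {s : ℕ} (hs : 1 ≤ s) :
    ∀ᵐ u : ℝ, Complex.exp (-(Complex.I * (s : ℂ) * (u : ℂ))) ≠ 1 := by
  have hcount : (Set.range fun n : ℤ => -(n * (2 * Real.pi) / s)).Countable :=
    Set.countable_range _
  filter_upwards [hcount.ae_notMem volume] with u hu h
  obtain ⟨n, hn⟩ := Complex.exp_eq_one_iff.mp h
  refine hu ⟨n, ?_⟩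
  have hs0 : (s : ℝ) ≠ 0 := by positivity
  have h2 : (s : ℂ) * u = -(n * (2 * Real.pi)) := by
    have hI : Complex.I * ((s : ℂ) * u) = Complex.I * -(n * (2 * Real.pi)) := by
      linear_combination -hn
    exact mul_left_cancel₀ Complex.I_ne_zero hI
  have h3 : (s : ℝ) * u = -(n * (2 * Real.pi)) := by exact_mod_cast h2
  simp only
  field_simp
  linarith

theorem continuousAt_lamFun (α : Polynomial ℝ) {β : Polynomial ℝ} (d : ℝ) {s : ℕ}
    (hβ : ∀ z : ℂ, ‖z‖ ≤ 1 → Polynomial.aeval z β ≠ 0) {z : ℂ} (hz : ‖z‖ ≤ 1) (hz1 : z ^ s ≠ 1) :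
    ContinuousAt (lamFun α β d s) z := by
  unfold lamFun
  refine ContinuousAt.mul (ContinuousAt.div ?_ ?_ (hβ z hz)) (ContinuousAt.cpow ?_ ?_ ?_)
  · exact (Polynomial.continuous_aeval α).continuousAt
  · exact (Polynomial.continuous_aeval β).continuousAt
  · fun_prop
  · fun_prop
  · left
    exact one_sub_re_pos (by rw [norm_pow]; exact pow_le_one₀ (norm_nonneg _) hz) hz1

/-- The majorant does not depend on `r`, which makes it usable for dominated convergence; its two
powers again cover the two signs of `d`. -/
theorem norm_lamFun_le {α β : Polynomial ℝ} (d : ℝ) {s : ℕ} {C : ℝ}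
    (hC0 : 0 ≤ C)
    (hC : ∀ z : ℂ, ‖z‖ ≤ 1 → ‖(Polynomial.aeval z α : ℂ) / Polynomial.aeval z β‖ ≤ C)
    {r : ℝ} (h0 : 0 ≤ r) (h1 : r ≤ 1) {u : ℝ}
    (hu : Complex.exp (-(Complex.I * (s : ℂ) * (u : ℂ))) ≠ 1) :
    ‖lamFun α β d s (r * Complex.exp (-(Complex.I * (u : ℂ))))‖ ≤
      C * (2 ^ (-d) + (1 / 2) ^ (-d) *
        ‖1 - Complex.exp (-(Complex.I * (s : ℂ) * (u : ℂ)))‖ ^ (-d)) := by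
  rw [lamFun, norm_mul, mul_pow, exp_neg_I_mul_pow, ← Complex.ofReal_neg, Complex.norm_cpow_real,
    ← Complex.ofReal_pow, ← Real.mul_rpow (by norm_num) (norm_nonneg _)]
  set w := Complex.exp (-(Complex.I * (s : ℂ) * (u : ℂ))) with hw
  have hw1 : ‖w‖ = 1 := norm_exp_neg_I_mul_mul s u
  have hr0 : 0 ≤ r ^ s := pow_nonneg h0 s
  have hr1 : r ^ s ≤ 1 := pow_le_one₀ h0 h1
  have hpos : 0 < ‖1 - w‖ := norm_pos_iff.mpr (sub_ne_zero.mpr hu.symm)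
  have hlow : 1 / 2 * ‖1 - w‖ ≤ ‖1 - ((r ^ s : ℝ) : ℂ) * w‖ := by
    have := norm_one_sub_le_two_mul hw1 hr0 hr1
    linarith
  have hup : ‖1 - ((r ^ s : ℝ) : ℂ) * w‖ ≤ 2 := by
    refine norm_one_sub_le_two ?_
    rw [norm_mul, hw1, mul_one, Complex.norm_real, Real.norm_of_nonneg hr0]
    exact hr1
  refine mul_le_mul (hC _ ?_) ?_ (by positivity) hC0
  · rw [norm_mul, norm_exp_neg_I_mul, mul_one, Complex.norm_real, Real.norm_of_nonneg h0]
    exact h1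
  · rcases le_total 0 (-d) with hd | hd
    · have := Real.rpow_le_rpow (norm_nonneg _) hup hd
      have h2 : 0 ≤ (1 / 2 * ‖1 - w‖) ^ (-d) := by positivity
      linarith
    · have := Real.rpow_le_rpow_of_nonpos (by positivity) hlow hd
      have h2 : (0 : ℝ) ≤ 2 ^ (-d) := by positivity
      linarith

/-- Abel limit: the identity at radius `r` passes to `r → 1`, with pointwise convergence off the
null set `e^{-isu} = 1` and a majorant integrable because `-d > -1`. -/
theorem integral_exp_mul_transfer (α : Polynomial ℝ) {β : Polynomial ℝ} {d : ℝ} {s : ℕ}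
    (hs : 1 ≤ s) (hβ : ∀ z : ℂ, ‖z‖ ≤ 1 → Polynomial.aeval z β ≠ 0) (hd : d < 1 / 2) (k : ℤ) :
    ∫ u in Set.Ioc (-Real.pi) Real.pi, Complex.exp (Complex.I * (k : ℂ) * (u : ℂ)) *
      transfer α β d s u = 2 * Real.pi * (lamCoeffInt α β d s k : ℂ) := by
  obtain ⟨C, hC0, hC⟩ := exists_norm_aeval_div_le α hβ
  set r : ℕ → ℝ := fun n => 1 - 1 / ((n : ℝ) + 1) with hr
  have hr0 : ∀ n, 0 ≤ r n := fun n => by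
    rw [hr, sub_nonneg, div_le_one (by positivity)]
    linarith [(Nat.cast_nonneg n : (0 : ℝ) ≤ n)]
  have hr1 : ∀ n, r n < 1 := fun n => by
    rw [hr, sub_lt_self_iff]
    positivity
  have hrlim : Tendsto r atTop (𝓝 1) := by
    simpa only [sub_zero] using (tendsto_one_div_add_atTop_nhds_zero_nat (𝕜 := ℝ)).const_sub 1
  have hrlim' : Tendsto (fun n => (r n : ℂ)) atTop (𝓝 1) := by
    simpa only [Complex.ofReal_one] using! (Complex.continuous_ofReal.tendsto 1).comp hrlim
  have hlim := tendsto_integral_of_dominated_convergence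
    (μ := volume.restrict (Set.Ioc (-Real.pi) Real.pi))
    (F := fun n u => Complex.exp (Complex.I * (k : ℂ) * (u : ℂ)) *
      lamFun α β d s (r n * Complex.exp (-(Complex.I * (u : ℂ)))))
    (f := fun u => Complex.exp (Complex.I * (k : ℂ) * (u : ℂ)) * transfer α β d s u)
    (fun u => C * (2 ^ (-d) + (1 / 2) ^ (-d) *
        ‖1 - Complex.exp (-(Complex.I * (s : ℂ) * (u : ℂ)))‖ ^ (-d)))
    (fun n => by
      refine (Measurable.mul (by fun_prop) ?_).aestronglyMeasurable
      exact measurable_lamFun_circle α β d s (r n))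
    (((integrable_const _).add
      ((integrableOn_rpow_norm_one_sub_exp (by linarith) hs).const_mul _)).const_mul _)
    (fun n => by
      filter_upwards [ae_restrict_of_ae (ae_exp_neg_I_mul_mul_ne_one hs)] with u hu
      rw [norm_mul, norm_exp_I_mul_int_mul, one_mul]
      exact norm_lamFun_le d hC0 hC (hr0 n) (hr1 n).le hu)
    (by
      filter_upwards [ae_restrict_of_ae (ae_exp_neg_I_mul_mul_ne_one hs)] with u hu
      refine Tendsto.const_mul _ ?_
      have hc := continuousAt_lamFun α d hβ (norm_exp_neg_I_mul u).le
        (s := s) (by rwa [exp_neg_I_mul_pow])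
      refine hc.tendsto.comp ?_
      simpa using hrlim'.mul_const (Complex.exp (-(Complex.I * (u : ℂ)))))
  simp only [integral_exp_mul_lamFun d hs hβ (hr0 _) (hr1 _) k] at hlim
  refine tendsto_nhds_unique hlim ?_
  simpa using (hrlim'.pow k.toNat).const_mul (2 * Real.pi * (lamCoeffInt α β d s k : ℂ))

/-! ### Parseval's identity and square summability -/

/-- **Parseval's identity** for two functions that are square integrable on `(a, b]`. -/
theorem hasSum_conj_fourierCoeffOn_mul {a b : ℝ} {f g : ℝ → ℂ} (hab : a < b)
    (hf : MemLp f 2 (volume.restrict (Set.Ioc a b)))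
    (hg : MemLp g 2 (volume.restrict (Set.Ioc a b))) :
    HasSum (fun i => (starRingEnd ℂ) (fourierCoeffOn hab f i) * fourierCoeffOn hab g i)
      ((b - a)⁻¹ • ∫ x in a..b, (starRingEnd ℂ) (f x) * g x) := by
  have := Fact.mk (by linarith : 0 < b - a)
  -- Writing `b = a + (b - a)` presents the interval as a fundamental domain of the circle of length
  -- `b - a`.
  rw [← add_sub_cancel a b] at hf hg
  have h := hf.memLp_liftIoc.haarAddCircle
  have h' := hg.memLp_liftIoc.haarAddCircle
  have key := fourierBasis.hasSum_inner_mul_inner h.toLp h'.toLp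
  have e1 : ∀ i, fourierCoeff (h.toLp) i = fourierCoeffOn hab f i := fun i => by
    simp [fourierCoeff_congr_ae h.coeFn_toLp, fourierCoeff_liftIoc_eq]
  have e2 : ∀ i, fourierCoeff (h'.toLp) i = fourierCoeffOn hab g i := fun i => by
    simp [fourierCoeff_congr_ae h'.coeFn_toLp, fourierCoeff_liftIoc_eq]
  have e3 : ∀ i, inner ℂ h.toLp (fourierBasis i) * inner ℂ (fourierBasis i) h'.toLp =
      (starRingEnd ℂ) (fourierCoeffOn hab f i) * fourierCoeffOn hab g i := fun i => by
    rw [← inner_conj_symm h.toLp, ← HilbertBasis.repr_apply_apply,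
      ← HilbertBasis.repr_apply_apply, fourierBasis_repr, fourierBasis_repr, e1, e2]
  have e4 : inner ℂ h.toLp h'.toLp = (b - a)⁻¹ • ∫ x in a..b, (starRingEnd ℂ) (f x) * g x := by
    have e5 : ∫ x in a..b, (starRingEnd ℂ) (f x) * g x =
        ∫ x in a..(a + (b - a)), (starRingEnd ℂ) (f x) * g x := by rw [add_sub_cancel]
    rw [e5, ← AddCircle.integral_liftIoc_eq_intervalIntegral, ← AddCircle.integral_haarAddCircle,
      L2.inner_def]
    apply integral_congr_ae
    filter_upwards [h.coeFn_toLp, h'.coeFn_toLp] with x hx hx'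
    rw [hx, hx', RCLike.inner_apply']
    rfl
  simp only [e3, e4] at key
  exact key

theorem fourierCoeffOn_exp_mul_transfer (α : Polynomial ℝ) {β : Polynomial ℝ} {d : ℝ} {s : ℕ}
    (hs : 1 ≤ s) (hβ : ∀ z : ℂ, ‖z‖ ≤ 1 → Polynomial.aeval z β ≠ 0) (hd : d < 1 / 2)
    (hab : -Real.pi < Real.pi) (h n : ℤ) :
    fourierCoeffOn hab (fun u : ℝ => Complex.exp (Complex.I * (h : ℂ) * (u : ℂ)) *
      transfer α β d s u) n = lamCoeffInt α β d s (h - n) := by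
  rw [fourierCoeffOn_eq_integral, intervalIntegral.integral_of_le hab.le]
  have hpi : (Real.pi : ℂ) ≠ 0 := by exact_mod_cast Real.pi_ne_zero
  have e : ∀ u : ℝ, fourier (-n) (u : AddCircle (Real.pi - -Real.pi)) •
      (Complex.exp (Complex.I * (h : ℂ) * (u : ℂ)) * transfer α β d s u) =
      Complex.exp (Complex.I * ((h - n : ℤ) : ℂ) * (u : ℂ)) * transfer α β d s u := by
    intro u
    rw [fourier_coe_apply, smul_eq_mul, ← mul_assoc, ← Complex.exp_add]
    congr 2
    push_cast
    field_simp
    ring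
  simp only [e]
  rw [integral_exp_mul_transfer α hs hβ hd, Complex.real_smul]
  push_cast
  field_simp
  ring

/-- Parseval for the pair `Λ`, `e^{ihu} Λ`: the factor `e^{ihu}` shifts the coefficients by `h`, and
the product with the conjugate is `e^{ihu} |Λ|²`. -/
theorem hasSum_lamCoeffInt_mul (α : Polynomial ℝ) {β : Polynomial ℝ} {d : ℝ} {s : ℕ}
    (hs : 1 ≤ s) (hβ : ∀ z : ℂ, ‖z‖ ≤ 1 → Polynomial.aeval z β ≠ 0) (hd : d < 1 / 2) (h : ℤ) :
    HasSum (fun k : ℤ => (lamCoeffInt α β d s k : ℂ) * lamCoeffInt α β d s (k + h))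
      ((2 * Real.pi : ℂ)⁻¹ * ∫ u in Set.Ioc (-Real.pi) Real.pi,
        Complex.exp (Complex.I * (h : ℂ) * (u : ℂ)) * (‖transfer α β d s u‖ : ℂ) ^ 2) := by
  have hab : -Real.pi < Real.pi := by linarith [Real.pi_pos]
  have hm := memLp_transfer α hs hβ hd
  have hm' : ∀ m : ℤ, MemLp (fun u : ℝ => Complex.exp (Complex.I * (m : ℂ) * (u : ℂ)) *
      transfer α β d s u) 2 (volume.restrict (Set.Ioc (-Real.pi) Real.pi)) := fun m => by
    refine MemLp.of_le hm ?_ (ae_of_all _ fun u => ?_)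
    · exact (Measurable.mul (by fun_prop) (measurable_transfer α β d s)).aestronglyMeasurable
    · rw [norm_mul, norm_exp_I_mul_int_mul, one_mul]
  have key := hasSum_conj_fourierCoeffOn_mul hab (hm' 0) (hm' h)
  simp only [fourierCoeffOn_exp_mul_transfer α hs hβ hd, Complex.conj_ofReal] at key
  -- The `n`-th coefficient is `λ_{h-n}`, so `n = -k` brings the sum to the form `λ_k λ_{k+h}`.
  rw [← (Equiv.neg ℤ).hasSum_iff] at key
  have e : ∀ u : ℝ, (starRingEnd ℂ) (Complex.exp (Complex.I * ((0 : ℤ) : ℂ) * (u : ℂ)) *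
      transfer α β d s u) * (Complex.exp (Complex.I * (h : ℂ) * (u : ℂ)) * transfer α β d s u) =
      Complex.exp (Complex.I * (h : ℂ) * (u : ℂ)) * (‖transfer α β d s u‖ : ℂ) ^ 2 := by
    intro u
    rw [← Complex.conj_mul']
    simp
    ring
  simp only [e] at key
  rw [intervalIntegral.integral_of_le hab.le, Complex.real_smul] at key
  convert key using 1
  · ext k
    simp [add_comm]
  · push_cast
    congr 2
    ring

theorem summable_lamCoeff_sq (α : Polynomial ℝ) {β : Polynomial ℝ} {d : ℝ} {s : ℕ}
    (hs : 1 ≤ s) (hβ : ∀ z : ℂ, ‖z‖ ≤ 1 → Polynomial.aeval z β ≠ 0) (hd : d < 1 / 2) :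
    Summable fun k : ℕ => lamCoeff α β d s k ^ 2 := by
  have h1 := (hasSum_lamCoeffInt_mul α hs hβ hd 0).summable.comp_injective Nat.cast_injective
  have h2 := (Complex.hasSum_re h1.hasSum).summable
  refine h2.congr fun k => ?_
  simp [sq]

/-! ### Orthogonal series in `L²` and their covariances -/

theorem summable_of_pairwise_inner_eq_zero {ι E : Type*} [NormedAddCommGroup E]
    [InnerProductSpace ℝ E] [CompleteSpace E] {w : ι → E}
    (horth : Pairwise fun i j => inner ℝ (w i) (w j) = 0) (hs : Summable fun i => ‖w i‖ ^ 2) :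
    Summable w := by
  have hV : OrthogonalFamily ℝ (fun i => (Submodule.span ℝ {w i} : Submodule ℝ E))
      fun i => (Submodule.span ℝ {w i}).subtypeₗᵢ := by
    refine OrthogonalFamily.of_pairwise fun i j hij => ?_
    rw [Function.onFun, Submodule.isOrtho_span]
    intro x hx y hy
    rw [Set.mem_singleton_iff.mp hx, Set.mem_singleton_iff.mp hy]
    exact horth hij
  exact (hV.summable_iff_norm_sq_summable
    fun i => ⟨w i, Submodule.mem_span_singleton_self (w i)⟩).mpr hs

section Probability

variable {Ω : Type*} [MeasurableSpace Ω]

theorem inner_toLp_eq_integral {P : Measure Ω} {f g : Ω → ℝ} (hf : MemLp f 2 P)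
    (hg : MemLp g 2 P) : inner ℝ (hf.toLp f) (hg.toLp g) = ∫ x, f x * g x ∂P := by
  rw [L2.inner_def]
  refine integral_congr_ae ?_
  filter_upwards [hf.coeFn_toLp, hg.coeFn_toLp] with x hx hx'
  rw [hx, hx', RCLike.inner_apply']
  rfl

/-- An almost surely convergent series of centred, pairwise uncorrelated random variables with
common variance and square summable weights converges in `L²`. -/
theorem exists_toLp_tendsto_of_ae_tendsto {P : Measure Ω} [IsProbabilityMeasure P]
    {W : ℕ → Ω → ℝ} {c : ℕ → ℝ} {v m : ℝ} {Y : Ω → ℝ} (hW : ∀ k, MemLp (W k) 2 P)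
    (horth : ∀ i j, i ≠ j → ∫ x, W i x * W j x ∂P = 0) (hvar : ∀ k, ∫ x, W k x * W k x ∂P = v)
    (hc : Summable fun k => c k ^ 2)
    (hlim : ∀ᵐ x ∂P, Tendsto (fun n : ℕ => m + ∑ k ∈ Finset.range n, c k * W k x) atTop
      (𝓝 (Y x))) :
    ∃ h : MemLp (fun x => Y x - m) 2 P,
      Tendsto (fun n : ℕ => ∑ k ∈ Finset.range n, c k • (hW k).toLp (W k)) atTop
        (𝓝 (h.toLp fun x => Y x - m)) := by
  have hsum : Summable fun k => c k • (hW k).toLp (W k) := by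
    refine summable_of_pairwise_inner_eq_zero (fun i j hij => ?_) ?_
    · simp only [real_inner_smul_left, real_inner_smul_right, inner_toLp_eq_integral,
        horth i j hij, mul_zero]
    · refine (hc.mul_right v).congr fun k => ?_
      rw [← real_inner_self_eq_norm_sq, real_inner_smul_left, real_inner_smul_right,
        inner_toLp_eq_integral, hvar]
      ring
  obtain ⟨L, hL⟩ := hsum
  have hL' := hL.tendsto_sum_nat
  -- A subsequence converges almost surely to the `L²` limit, which must therefore agree with the
  -- given almost sure limit.
  obtain ⟨ns, hns, hns'⟩ := (tendstoInMeasure_of_tendsto_Lp hL').exists_seq_tendsto_ae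
  have hcoe : ∀ n : ℕ, ((∑ k ∈ Finset.range n, c k • (hW k).toLp (W k) : Lp ℝ 2 P) : Ω → ℝ) =ᵐ[P]
      fun x => ∑ k ∈ Finset.range n, c k * W k x := by
    intro n
    induction n with
    | zero =>
      simp only [Finset.range_zero, Finset.sum_empty]
      exact Lp.coeFn_zero _ _ _
    | succ n ih =>
      rw [Finset.sum_range_succ]
      filter_upwards [Lp.coeFn_add (∑ k ∈ Finset.range n, c k • (hW k).toLp (W k))
        (c n • (hW n).toLp (W n)), ih, Lp.coeFn_smul (c n) ((hW n).toLp (W n)),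
        (hW n).coeFn_toLp] with x h1 h2 h3 h4
      rw [h1, Pi.add_apply, h2, h3, Pi.smul_apply, h4, Finset.sum_range_succ, smul_eq_mul]
  have hae : (L : Ω → ℝ) =ᵐ[P] fun x => Y x - m := by
    filter_upwards [hns', ae_all_iff.mpr hcoe, hlim] with x h1 h2 h3
    simp only [h2] at h1
    have h4 := (h3.comp hns.tendsto_atTop).sub_const m
    simp only [Function.comp_def, add_sub_cancel_left] at h4
    exact tendsto_nhds_unique h1 h4
  have hmem : MemLp (fun x => Y x - m) 2 P := (memLp_congr_ae hae).mp (Lp.memLp L)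
  refine ⟨hmem, ?_⟩
  have : hmem.toLp (fun x => Y x - m) = L := by
    rw [← Lp.toLp_coeFn L (Lp.memLp L)]
    exact MemLp.toLp_congr _ _ hae.symm
  rw [this]
  exact hL'

/-- Covariance with `V` is an `L²` inner product once one factor is centred, hence continuous along
the `L²` convergent partial sums. -/
theorem tendsto_covariance_of_ae_tendsto {P : Measure Ω} [IsProbabilityMeasure P]
    {W : ℕ → Ω → ℝ} {c : ℕ → ℝ} {v m : ℝ} {Y : Ω → ℝ} (hW : ∀ k, MemLp (W k) 2 P)
    (hmean : ∀ k, ∫ x, W k x ∂P = 0)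
    (horth : ∀ i j, i ≠ j → cov[W i, W j; P] = 0) (hvar : ∀ k, cov[W k, W k; P] = v)
    (hc : Summable fun k => c k ^ 2)
    (hlim : ∀ᵐ x ∂P, Tendsto (fun n : ℕ => m + ∑ k ∈ Finset.range n, c k * W k x) atTop
      (𝓝 (Y x))) :
    MemLp Y 2 P ∧ ∫ x, Y x ∂P = m ∧ ∀ V : Ω → ℝ, MemLp V 2 P →
      Tendsto (fun n : ℕ => ∑ k ∈ Finset.range n, c k * cov[W k, V; P]) atTop
        (𝓝 (cov[Y, V; P])) := by
  have hcov : ∀ k (V : Ω → ℝ), MemLp V 2 P → cov[W k, V; P] = ∫ x, W k x * V x ∂P := by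
    intro k V hV
    rw [covariance_eq_sub (hW k) hV, hmean, zero_mul, sub_zero]
    rfl
  obtain ⟨hmem, hten⟩ := exists_toLp_tendsto_of_ae_tendsto (v := v) hW
    (fun i j hij => by rw [← hcov i _ (hW j), horth i j hij])
    (fun k => by rw [← hcov k _ (hW k), hvar]) hc hlim
  have key : ∀ V : Ω → ℝ, MemLp V 2 P →
      Tendsto (fun n : ℕ => ∑ k ∈ Finset.range n, c k * ∫ x, W k x * V x ∂P) atTop
        (𝓝 (∫ x, (Y x - m) * V x ∂P)) := by
    intro V hV
    have h := hten.inner (𝕜 := ℝ) (tendsto_const_nhds (x := hV.toLp V))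
    simpa only [sum_inner, real_inner_smul_left, inner_toLp_eq_integral] using h
  have hY : MemLp Y 2 P := by
    have := hmem.add (memLp_const m)
    refine (memLp_congr_ae (ae_of_all _ fun x => ?_)).mp this
    simp
  have hYm : ∫ x, Y x ∂P = m := by
    -- Pairing with the constant 1 identifies the mean, since every partial sum is centred.
    have h := key (fun _ => 1) (memLp_const 1)
    simp only [mul_one, hmean, mul_zero, Finset.sum_const_zero] at h
    have h2 := tendsto_nhds_unique h tendsto_const_nhds
    rw [integral_sub (hY.integrable (by norm_num)) (integrable_const m)] at h2
    simp only [integral_const, probReal_univ, one_smul] at h2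
    linarith
  refine ⟨hY, hYm, fun V hV => ?_⟩
  have e : cov[Y, V; P] = ∫ x, (Y x - m) * V x ∂P := by
    have h1 : cov[Y, V; P] = cov[fun x => Y x - m, V; P] :=
      (covariance_sub_const_left (hY.integrable (by norm_num)) m).symm
    have h2 : ∫ x, Y x - m ∂P = 0 := by
      rw [integral_sub (hY.integrable (by norm_num)) (integrable_const m), hYm]
      simp
    rw [h1, covariance_eq_sub hmem hV, h2, zero_mul, sub_zero]
    rfl
  rw [e]
  simp only [hcov _ V hV]
  exact key V hV

theorem covariance_comp_innov {P : Measure Ω} [IsProbabilityMeasure P] {Z : ℤ → Ω → ℝ}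
    (hm : ∀ t, Measurable (Z t)) (hind : iIndepFun Z P) (hid : ∀ t, IdentDistrib (Z t) (Z 0) P P)
    {G H : ℝ → ℝ} (hG : Measurable G) (hH : Measurable H)
    (hG2 : ∀ t, MemLp (fun x => G (Z t x)) 2 P) (hH2 : ∀ t, MemLp (fun x => H (Z t x)) 2 P)
    (t u : ℤ) :
    cov[fun x => G (Z t x), fun x => H (Z u x); P] =
      if t = u then cov[fun x => G (Z 0 x), fun x => H (Z 0 x); P] else 0 := by
  split_ifs with h
  · subst h
    rw [← covariance_map_fun hG.aestronglyMeasurable hH.aestronglyMeasurable (hm t).aemeasurable,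
      ← covariance_map_fun hG.aestronglyMeasurable hH.aestronglyMeasurable (hm 0).aemeasurable,
      (hid t).map_eq]
  · exact ((hind.indepFun h).comp hG hH).covariance_eq_zero (hG2 t) (hH2 u)

theorem covariance_congr_ae {P : Measure Ω} {X X' Y Y' : Ω → ℝ} (hX : X =ᵐ[P] X')
    (hY : Y =ᵐ[P] Y') : cov[X, Y; P] = cov[X', Y'; P] := by
  rw [covariance, covariance, integral_congr_ae hX, integral_congr_ae hY]
  refine integral_congr_ae ?_
  filter_upwards [hX, hY] with x h1 h2
  rw [h1, h2]

/-- Only `k = t - 1 - u` can contribute. For `u ≥ t` no such `k` exists, in accordance with the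
extension of `λ` by zero: the volatility depends on past innovations only. -/
theorem tendsto_sum_lamCoeff_mul_ite (α β : Polynomial ℝ) (d : ℝ) (s : ℕ) (t u : ℤ) (C : ℝ) :
    Tendsto (fun n : ℕ => ∑ k ∈ Finset.range n, lamCoeff α β d s k *
      (if t - 1 - (k : ℤ) = u then C else 0)) atTop (𝓝 (lamCoeffInt α β d s (t - 1 - u) * C)) := by
  refine HasSum.tendsto_sum_nat ?_
  rcases le_or_gt 0 (t - 1 - u) with h | h
  · obtain ⟨m, hm⟩ := Int.eq_ofNat_of_zero_le h
    rw [hm, lamCoeffInt_natCast]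
    have : ∀ k : ℕ, lamCoeff α β d s k * (if t - 1 - (k : ℤ) = u then C else 0) =
        if k = m then lamCoeff α β d s m * C else 0 := by
      intro k
      by_cases hk : k = m
      · subst hk
        simp [show t - 1 - (k : ℤ) = u by omega]
      · simp [hk, show ¬ t - 1 - (k : ℤ) = u by omega]
    simp only [this]
    exact hasSum_ite_eq m _
  · rw [lamCoeffInt_of_neg _ _ _ _ h, zero_mul]
    have : ∀ k : ℕ, lamCoeff α β d s k * (if t - 1 - (k : ℤ) = u then C else 0) = 0 := by
      intro k
      simp [show ¬ t - 1 - (k : ℤ) = u by omega]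
    simp only [this]
    exact hasSum_zero

end Probability

/-! ### Symmetry, integrability and Fourier coefficients of the densities -/

theorem transfer_neg (α β : Polynomial ℝ) (d : ℝ) {s : ℕ} (u : ℝ) :
    transfer α β d s (-u) = (starRingEnd ℂ) (transfer α β d s u) := by
  have he : Complex.exp (-(Complex.I * ((-u : ℝ) : ℂ))) =
      (starRingEnd ℂ) (Complex.exp (-(Complex.I * (u : ℂ)))) := by
    rw [← Complex.exp_conj]
    simp
  have hp : ∀ (f : Polynomial ℝ) (z : ℂ), Polynomial.aeval ((starRingEnd ℂ) z) f =
      (starRingEnd ℂ) (Polynomial.aeval z f) := fun f z =>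
    Polynomial.aeval_algHom_apply Complex.conjAe.toAlgHom z f
  -- Conjugation commutes with the principal power except on the negative real axis, which a base of
  -- nonnegative real part avoids.
  have harg : (1 - Complex.exp (-(Complex.I * (u : ℂ))) ^ s).arg ≠ Real.pi := by
    rw [Ne, Complex.arg_eq_pi_iff, not_and_or]
    left
    rw [not_lt]
    by_cases h1 : Complex.exp (-(Complex.I * (u : ℂ))) ^ s = 1
    · simp [h1]
    · refine (one_sub_re_pos ?_ h1).le
      rw [norm_pow, norm_exp_neg_I_mul, one_pow]
  rw [transfer, transfer, lamFun, lamFun, he, hp, hp, map_mul, map_div₀]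
  congr 1
  have h2 := Complex.conj_cpow (1 - Complex.exp (-(Complex.I * (u : ℂ))) ^ s) (-(d : ℂ)) harg
  rw [map_neg, Complex.conj_ofReal, map_sub, map_one, map_pow] at h2
  exact h2

theorem re_exp_mul_transfer_neg (α β : Polynomial ℝ) (d : ℝ) (s : ℕ) (u : ℝ) :
    (Complex.exp (-(Complex.I * ((-u : ℝ) : ℂ))) * transfer α β d s (-u)).re =
      (Complex.exp (-(Complex.I * (u : ℂ))) * transfer α β d s u).re := by
  have he : Complex.exp (-(Complex.I * ((-u : ℝ) : ℂ))) =
      (starRingEnd ℂ) (Complex.exp (-(Complex.I * (u : ℂ)))) := by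
    rw [← Complex.exp_conj]
    simp
  rw [transfer_neg, he, ← map_mul, Complex.conj_re]

theorem specLogVol_neg (α β : Polynomial ℝ) (d : ℝ) (s : ℕ) (v u : ℝ) :
    specLogVol α β d s v (-u) = specLogVol α β d s v u := by
  rw [specLogVol_eq, specLogVol_eq, transfer_neg, RCLike.norm_conj]

theorem integrableOn_specLogVol (α : Polynomial ℝ) {β : Polynomial ℝ} {d : ℝ} {s : ℕ}
    (hs : 1 ≤ s) (hβ : ∀ z : ℂ, ‖z‖ ≤ 1 → Polynomial.aeval z β ≠ 0) (hd : d < 1 / 2) (v : ℝ) :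
    IntegrableOn (specLogVol α β d s v) (Set.Ioc (-Real.pi) Real.pi) := by
  have h : specLogVol α β d s v = fun u => v / (2 * Real.pi) * ‖transfer α β d s u‖ ^ 2 :=
    funext fun u => specLogVol_eq α β d s v u
  rw [h]
  exact ((memLp_transfer α hs hβ hd).integrable_norm_pow two_ne_zero).const_mul _

theorem integrableOn_re_exp_mul_transfer (α : Polynomial ℝ) {β : Polynomial ℝ} {d : ℝ} {s : ℕ}
    (hs : 1 ≤ s) (hβ : ∀ z : ℂ, ‖z‖ ≤ 1 → Polynomial.aeval z β ≠ 0) (hd : d < 1 / 2) :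
    IntegrableOn (fun u : ℝ => (Complex.exp (-(Complex.I * (u : ℂ))) * transfer α β d s u).re)
      (Set.Ioc (-Real.pi) Real.pi) := by
  have h := (memLp_transfer α hs hβ hd).integrable (by norm_num)
  refine Integrable.mono h ?_ (ae_of_all _ fun u => ?_)
  · exact (Complex.measurable_re.comp
      (Measurable.mul (by fun_prop) (measurable_transfer α β d s))).aestronglyMeasurable
  · refine (Complex.abs_re_le_norm _).trans ?_
    rw [norm_mul, norm_exp_neg_I_mul, one_mul]

theorem integrableOn_exp_mul_ofReal {f : ℝ → ℝ}
    (hf : IntegrableOn f (Set.Ioc (-Real.pi) Real.pi)) (h : ℤ) :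
    IntegrableOn (fun u : ℝ => Complex.exp (Complex.I * (h : ℂ) * (u : ℂ)) * (f u : ℂ))
      (Set.Ioc (-Real.pi) Real.pi) := by
  refine Integrable.mono hf ?_ (ae_of_all _ fun u => ?_)
  · have h1 : Measurable fun u : ℝ => Complex.exp (Complex.I * (h : ℂ) * (u : ℂ)) := by fun_prop
    exact h1.aestronglyMeasurable.mul
      (Complex.continuous_ofReal.comp_aestronglyMeasurable hf.aestronglyMeasurable)
  · rw [norm_mul, norm_exp_I_mul_int_mul, one_mul, Complex.norm_real]

theorem integral_exp_mul_specLogVol (α : Polynomial ℝ) {β : Polynomial ℝ} {d : ℝ} {s : ℕ}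
    (hs : 1 ≤ s) (hβ : ∀ z : ℂ, ‖z‖ ≤ 1 → Polynomial.aeval z β ≠ 0) (hd : d < 1 / 2) (v : ℝ)
    (h : ℤ) :
    ∫ u in Set.Ioc (-Real.pi) Real.pi, Complex.exp (Complex.I * (h : ℂ) * (u : ℂ)) *
      (specLogVol α β d s v u : ℂ) =
    ((v * ∑' k : ℤ, lamCoeffInt α β d s k * lamCoeffInt α β d s (k + h) : ℝ) : ℂ) := by
  have hsum := (hasSum_lamCoeffInt_mul α hs hβ hd h).tsum_eq
  simp only [← Complex.ofReal_mul] at hsum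
  rw [← Complex.ofReal_tsum] at hsum
  rw [Complex.ofReal_mul, hsum]
  simp only [specLogVol_eq]
  rw [← integral_const_mul, ← integral_const_mul]
  refine integral_congr_ae (ae_of_all _ fun u => ?_)
  simp only
  push_cast
  ring

/-- The real part is half the sum of a function and its conjugate. Conjugation reverses the
frequency, whence the two indices `h - 1` and `-h - 1`. -/
theorem integral_exp_mul_re_exp_mul_transfer (α : Polynomial ℝ) {β : Polynomial ℝ} {d : ℝ}
    {s : ℕ} (hs : 1 ≤ s) (hβ : ∀ z : ℂ, ‖z‖ ≤ 1 → Polynomial.aeval z β ≠ 0) (hd : d < 1 / 2)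
    (h : ℤ) :
    ∫ u in Set.Ioc (-Real.pi) Real.pi, Complex.exp (Complex.I * (h : ℂ) * (u : ℂ)) *
      ((Complex.exp (-(Complex.I * (u : ℂ))) * transfer α β d s u).re : ℂ) =
    ((Real.pi * (lamCoeffInt α β d s (h - 1) + lamCoeffInt α β d s (-h - 1)) : ℝ) : ℂ) := by
  have hi : ∀ m : ℤ, IntegrableOn (fun u : ℝ => Complex.exp (Complex.I * (m : ℂ) * (u : ℂ)) *
      transfer α β d s u) (Set.Ioc (-Real.pi) Real.pi) := fun m => by
    refine Integrable.mono ((memLp_transfer α hs hβ hd).integrable (by norm_num)) ?_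
      (ae_of_all _ fun u => ?_)
    · exact (Measurable.mul (by fun_prop) (measurable_transfer α β d s)).aestronglyMeasurable
    · rw [norm_mul, norm_exp_I_mul_int_mul, one_mul]
  have e : ∀ u : ℝ, Complex.exp (Complex.I * (h : ℂ) * (u : ℂ)) *
      ((Complex.exp (-(Complex.I * (u : ℂ))) * transfer α β d s u).re : ℂ) =
      (1 / 2 : ℂ) * (Complex.exp (Complex.I * ((h - 1 : ℤ) : ℂ) * (u : ℂ)) * transfer α β d s u) +
      (1 / 2 : ℂ) * (starRingEnd ℂ)
        (Complex.exp (Complex.I * ((-h - 1 : ℤ) : ℂ) * (u : ℂ)) * transfer α β d s u) := by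
    intro u
    have e1 : Complex.exp (Complex.I * ((h - 1 : ℤ) : ℂ) * (u : ℂ)) =
        Complex.exp (Complex.I * (h : ℂ) * (u : ℂ)) * Complex.exp (-(Complex.I * (u : ℂ))) := by
      rw [← Complex.exp_add]
      congr 1
      push_cast
      ring
    have e2 : (starRingEnd ℂ) (Complex.exp (Complex.I * ((-h - 1 : ℤ) : ℂ) * (u : ℂ))) =
        Complex.exp (Complex.I * (h : ℂ) * (u : ℂ)) *
          (starRingEnd ℂ) (Complex.exp (-(Complex.I * (u : ℂ)))) := by
      rw [← Complex.exp_conj, ← Complex.exp_conj, ← Complex.exp_add]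
      congr 1
      simp
      ring
    rw [Complex.re_eq_add_conj, map_mul, map_mul, e1, e2]
    ring
  have hconj : Integrable (fun u : ℝ => (starRingEnd ℂ)
      (Complex.exp (Complex.I * ((-h - 1 : ℤ) : ℂ) * (u : ℂ)) * transfer α β d s u))
      (volume.restrict (Set.Ioc (-Real.pi) Real.pi)) :=
    Complex.conjCLE.toContinuousLinearMap.integrable_comp (hi (-h - 1))
  simp only [e]
  rw [integral_add ((hi _).const_mul _) (hconj.const_mul _), integral_const_mul,
    integral_const_mul, integral_conj, integral_exp_mul_transfer α hs hβ hd,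
    integral_exp_mul_transfer α hs hβ hd]
  simp only [map_mul, Complex.conj_ofReal, map_ofNat]
  push_cast
  ring

theorem integral_exp_mul_const (v : ℝ) (h : ℤ) :
    ∫ u in Set.Ioc (-Real.pi) Real.pi, Complex.exp (Complex.I * (h : ℂ) * (u : ℂ)) *
      ((v / (2 * Real.pi) : ℝ) : ℂ) = ((if h = 0 then v else 0 : ℝ) : ℂ) := by
  rw [integral_mul_const, integral_exp_I_mul_int_mul]
  have hpi : (Real.pi : ℂ) ≠ 0 := by exact_mod_cast Real.pi_ne_zero
  split_ifs
  · push_cast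
    field_simp
  · simp

/-! ### Second-order structure of the model -/

section Model

variable {Ω : Type*} [MeasurableSpace Ω]

/-- This is the variance of `aX + Y`; it yields the nonnegativity of the density of `ln X²`. -/
theorem quadratic_covariance_nonneg {P : Measure Ω} [IsProbabilityMeasure P] {X Y : Ω → ℝ}
    (hX : MemLp X 2 P) (hY : MemLp Y 2 P) (a : ℝ) :
    0 ≤ a ^ 2 * Var[X; P] + 2 * a * cov[X, Y; P] + Var[Y; P] := by
  have h := variance_nonneg ((fun x => a * X x) + Y) P
  rw [variance_add (hX.const_mul a) hY, covariance_const_mul_left] at h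
  have h2 : Var[fun x => a * X x; P] = a ^ 2 * Var[X; P] := by
    rw [← covariance_self (hX.const_mul a).aestronglyMeasurable.aemeasurable,
      covariance_const_mul_left, covariance_const_mul_right,
      covariance_self hX.aestronglyMeasurable.aemeasurable]
    ring
  rw [h2] at h
  linarith

variable {P : Measure Ω} {p q : ℕ} {a b : ℕ → ℝ} {d : ℝ} {s : ℕ}
  {ω θ γ : ℝ} {Z σ X : ℤ → Ω → ℝ}

/-- Since `E|Z_t|` does not depend on `t`, one fixed measurable function of the innovation serves
for all times. -/
theorem IsSFIEGARCH.gProc_eq (hX : IsSFIEGARCH P p q a b d s ω θ γ Z σ X) (t : ℤ) :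
    gProc P θ γ Z t = fun x => (fun z => θ * z + γ * (|z| - ∫ y, |Z 0 y| ∂P)) (Z t x) := by
  have h : ∫ y, |Z t y| ∂P = ∫ y, |Z 0 y| ∂P := ((hX.innov_identDistrib t).norm).integral_eq
  funext x
  rw [gProc, h]

/-- `Z_t ≠ 0` is needed because `Real.log 0 = 0` would break the additivity of the logarithm. -/
theorem IsSFIEGARCH.log_sq_eq (hX : IsSFIEGARCH P p q a b d s ω θ γ Z σ X)
    (hZ : ∀ t, ∀ᵐ x ∂P, Z t x ≠ 0) (t : ℤ) :
    (fun x => Real.log (X t x ^ 2)) =ᵐ[P]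
      (fun x => Real.log (σ t x ^ 2)) + fun x => Real.log (Z t x ^ 2) := by
  filter_upwards [hX.eq_mul t, hX.vol_pos t, hZ t] with x h1 h2 h3
  rw [Pi.add_apply, h1, mul_pow, Real.log_mul (by positivity) (by positivity)]

variable [IsProbabilityMeasure P]

theorem IsSFIEGARCH.memLp_gProc (hX : IsSFIEGARCH P p q a b d s ω θ γ Z σ X) (t : ℤ) :
    MemLp (gProc P θ γ Z t) 2 P :=
  ((hX.innov_memLp t).const_mul θ).add
    (((hX.innov_memLp t).norm.sub (memLp_const _)).const_mul γ)

theorem IsSFIEGARCH.integral_gProc (hX : IsSFIEGARCH P p q a b d s ω θ γ Z σ X) (t : ℤ) :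
    ∫ x, gProc P θ γ Z t x ∂P = 0 := by
  have hi : Integrable (Z t) P := (hX.innov_memLp t).integrable (by norm_num)
  have hi2 : Integrable (fun x => |Z t x| - ∫ y, |Z t y| ∂P) P := hi.abs.sub (integrable_const _)
  simp only [gProc]
  rw [integral_add (hi.const_mul θ) (hi2.const_mul γ), integral_const_mul, integral_const_mul,
    integral_sub hi.abs (integrable_const _), hX.innov_mean]
  simp

theorem IsSFIEGARCH.covariance_gProc (hX : IsSFIEGARCH P p q a b d s ω θ γ Z σ X) (t u : ℤ) :
    cov[gProc P θ γ Z t, gProc P θ γ Z u; P] = if t = u then gVar P θ γ Z else 0 := by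
  have hm := fun t => hX.memLp_gProc t
  rw [gVar, ← covariance_self (hm 0).aestronglyMeasurable.aemeasurable]
  simp only [hX.gProc_eq] at hm ⊢
  have hG : Measurable fun z : ℝ => θ * z + γ * (|z| - ∫ y, |Z 0 y| ∂P) := by fun_prop
  exact covariance_comp_innov hX.innov_measurable hX.innov_indep hX.innov_identDistrib
    hG hG hm hm t u

theorem IsSFIEGARCH.covariance_gProc_log (hX : IsSFIEGARCH P p q a b d s ω θ γ Z σ X)
    (hlogZ : ∀ t, MemLp (fun x => Real.log (Z t x ^ 2)) 2 P) (t u : ℤ) :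
    cov[gProc P θ γ Z t, fun x => Real.log (Z u x ^ 2); P] =
      if t = u then covConst P θ γ Z else 0 := by
  have hm := fun t => hX.memLp_gProc t
  rw [covConst]
  simp only [hX.gProc_eq] at hm ⊢
  have hG : Measurable fun z : ℝ => θ * z + γ * (|z| - ∫ y, |Z 0 y| ∂P) := by fun_prop
  exact covariance_comp_innov (H := fun z => Real.log (z ^ 2)) hX.innov_measurable hX.innov_indep
    hX.innov_identDistrib hG (by fun_prop) hm hlogZ t u

theorem IsSFIEGARCH.covariance_log_innov (hX : IsSFIEGARCH P p q a b d s ω θ γ Z σ X)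
    (hlogZ : ∀ t, MemLp (fun x => Real.log (Z t x ^ 2)) 2 P) (t u : ℤ) :
    cov[fun x => Real.log (Z t x ^ 2), fun x => Real.log (Z u x ^ 2); P] =
      if t = u then Var[fun x => Real.log (Z 0 x ^ 2); P] else 0 := by
  rw [← covariance_self (hlogZ 0).aestronglyMeasurable.aemeasurable]
  exact covariance_comp_innov (G := fun z => Real.log (z ^ 2)) (H := fun z => Real.log (z ^ 2))
    hX.innov_measurable hX.innov_indep hX.innov_identDistrib (by fun_prop) (by fun_prop)
    hlogZ hlogZ t u

theorem IsSFIEGARCH.log_vol_spec (hX : IsSFIEGARCH P p q a b d s ω θ γ Z σ X) (hd : d < 1 / 2)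
    (t : ℤ) :
    MemLp (fun x => Real.log (σ t x ^ 2)) 2 P ∧ ∫ x, Real.log (σ t x ^ 2) ∂P = ω ∧
      ∀ V : Ω → ℝ, MemLp V 2 P → Tendsto (fun n : ℕ => ∑ k ∈ Finset.range n,
        lamCoeff (lagPoly p a) (lagPoly q b) d s k * cov[gProc P θ γ Z (t - 1 - (k : ℤ)), V; P])
        atTop (𝓝 (cov[fun x => Real.log (σ t x ^ 2), V; P])) := by
  refine tendsto_covariance_of_ae_tendsto (W := fun k : ℕ => gProc P θ γ Z (t - 1 - (k : ℤ)))
    (v := gVar P θ γ Z) (fun k => hX.memLp_gProc _) (fun k => hX.integral_gProc _)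
    (fun i j hij => ?_) (fun k => ?_)
    (summable_lamCoeff_sq _ hX.period_pos hX.beta_ne_zero hd) (hX.log_vol t)
  · rw [hX.covariance_gProc, if_neg (by omega)]
  · rw [hX.covariance_gProc, if_pos rfl]

theorem IsSFIEGARCH.covariance_log_vol_gProc (hX : IsSFIEGARCH P p q a b d s ω θ γ Z σ X)
    (hd : d < 1 / 2) (t u : ℤ) :
    cov[fun x => Real.log (σ t x ^ 2), gProc P θ γ Z u; P] =
      lamCoeffInt (lagPoly p a) (lagPoly q b) d s (t - 1 - u) * gVar P θ γ Z := by
  have h := (hX.log_vol_spec hd t).2.2 _ (hX.memLp_gProc u)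
  simp only [hX.covariance_gProc] at h
  exact tendsto_nhds_unique h (tendsto_sum_lamCoeff_mul_ite _ _ _ _ _ _ _)

theorem IsSFIEGARCH.covariance_log_vol_log_innov (hX : IsSFIEGARCH P p q a b d s ω θ γ Z σ X)
    (hd : d < 1 / 2) (hlogZ : ∀ t, MemLp (fun x => Real.log (Z t x ^ 2)) 2 P) (t u : ℤ) :
    cov[fun x => Real.log (σ t x ^ 2), fun x => Real.log (Z u x ^ 2); P] =
      lamCoeffInt (lagPoly p a) (lagPoly q b) d s (t - 1 - u) * covConst P θ γ Z := by
  have h := (hX.log_vol_spec hd t).2.2 _ (hlogZ u)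
  simp only [hX.covariance_gProc_log hlogZ] at h
  exact tendsto_nhds_unique h (tendsto_sum_lamCoeff_mul_ite _ _ _ _ _ _ _)

/-- The termwise formula is used twice: first against `g(Z_u)`, then with `ln σ_{t+h}²` itself as
the test variable. -/
theorem IsSFIEGARCH.covariance_log_vol (hX : IsSFIEGARCH P p q a b d s ω θ γ Z σ X)
    (hd : d < 1 / 2) (t h : ℤ) :
    cov[fun x => Real.log (σ t x ^ 2), fun x => Real.log (σ (t + h) x ^ 2); P] =
      gVar P θ γ Z * ∑' k : ℤ, lamCoeffInt (lagPoly p a) (lagPoly q b) d s k *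
        lamCoeffInt (lagPoly p a) (lagPoly q b) d s (k + h) := by
  have hlim := (hX.log_vol_spec hd t).2.2 _ (hX.log_vol_spec hd (t + h)).1
  simp only [fun u => covariance_comm (μ := P) (gProc P θ γ Z u),
    hX.covariance_log_vol_gProc hd] at hlim
  have hs1 : Summable fun k : ℤ => lamCoeffInt (lagPoly p a) (lagPoly q b) d s k *
      lamCoeffInt (lagPoly p a) (lagPoly q b) d s (k + h) := by
    have := (hasSum_lamCoeffInt_mul (lagPoly p a) hX.period_pos hX.beta_ne_zero hd h).summable
    simp only [← Complex.ofReal_mul] at this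
    exact Complex.summable_ofReal.mp this
  have hs2 := hs1.hasSum.mul_left (gVar P θ γ Z)
  -- The two-sided sum reduces to `k ≥ 0`, as the first factor vanishes for negative `k`.
  rw [← (Nat.cast_injective (R := ℤ)).hasSum_iff (fun k hk => by
    have : k < 0 := by
      by_contra hk'
      exact hk ⟨k.toNat, Int.toNat_of_nonneg (not_lt.mp hk')⟩
    rw [lamCoeffInt_of_neg _ _ _ _ this, zero_mul, mul_zero])] at hs2
  refine tendsto_nhds_unique hlim (hs2.tendsto_sum_nat.congr fun n => ?_)
  refine Finset.sum_congr rfl fun k _ => ?_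
  rw [Function.comp_apply, lamCoeffInt_natCast,
    show t + h - 1 - (t - 1 - (k : ℤ)) = k + h by ring]
  ring

/-! ### The three spectral densities -/

theorem IsSFIEGARCH.isSpectralDensity_log_vol (hX : IsSFIEGARCH P p q a b d s ω θ γ Z σ X)
    (hd : d < 1 / 2) :
    IsSpectralDensity P (fun t x => Real.log (σ t x ^ 2))
      (specLogVol (lagPoly p a) (lagPoly q b) d s (gVar P θ γ Z)) where
  stationary :=
    { memLp := fun t => (hX.log_vol_spec hd t).1
      mean_eq := fun t => by rw [(hX.log_vol_spec hd t).2.1, (hX.log_vol_spec hd 0).2.1]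
      cov_eq := fun t h => by
        rw [hX.covariance_log_vol hd, ← hX.covariance_log_vol hd 0 h, zero_add] }
  nonneg := fun u _ => by
    have : 0 ≤ gVar P θ γ Z := variance_nonneg _ _
    have := Real.pi_pos
    rw [specLogVol_eq]
    positivity
  even := fun u _ => specLogVol_neg _ _ _ _ _ _
  integrableOn := integrableOn_specLogVol _ hX.period_pos hX.beta_ne_zero hd _
  autocov_eq := fun h => by
    rw [integral_exp_mul_specLogVol _ hX.period_pos hX.beta_ne_zero hd,
      ← hX.covariance_log_vol hd 0 h, zero_add]

theorem IsSFIEGARCH.isSpectralDensity_log_innov (hX : IsSFIEGARCH P p q a b d s ω θ γ Z σ X)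
    (hlogZ : ∀ t, MemLp (fun x => Real.log (Z t x ^ 2)) 2 P) :
    IsSpectralDensity P (fun t x => Real.log (Z t x ^ 2)) (specLogInnov P Z) where
  stationary :=
    { memLp := hlogZ
      mean_eq := fun t => ((hX.innov_identDistrib t).comp (u := fun z => Real.log (z ^ 2))
        (by fun_prop)).integral_eq
      cov_eq := fun t h => by
        rw [hX.covariance_log_innov hlogZ, hX.covariance_log_innov hlogZ]
        exact if_congr (by rw [left_eq_add, eq_comm]) rfl rfl }
  nonneg := fun u _ => by
    have := variance_nonneg (fun x => Real.log (Z 0 x ^ 2)) P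
    have := Real.pi_pos
    rw [specLogInnov]
    positivity
  even := fun u _ => rfl
  integrableOn := integrable_const _
  autocov_eq := fun h => by
    simp only [specLogInnov]
    rw [integral_exp_mul_const, hX.covariance_log_innov hlogZ]
    simp only [eq_comm]

/-- Bilinearity gives four terms. The cross terms are `λ_{h-1}`, from `Z_t` acting on `σ_{t+h}`, and
`λ_{-h-1}`, from `Z_{t+h}` acting on `σ_t`. -/
theorem IsSFIEGARCH.covariance_log_sq (hX : IsSFIEGARCH P p q a b d s ω θ γ Z σ X)
    (hd : d < 1 / 2) (hZ : ∀ t, ∀ᵐ x ∂P, Z t x ≠ 0)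
    (hlogZ : ∀ t, MemLp (fun x => Real.log (Z t x ^ 2)) 2 P) (t h : ℤ) :
    cov[fun x => Real.log (X t x ^ 2), fun x => Real.log (X (t + h) x ^ 2); P] =
      gVar P θ γ Z * (∑' k : ℤ, lamCoeffInt (lagPoly p a) (lagPoly q b) d s k *
        lamCoeffInt (lagPoly p a) (lagPoly q b) d s (k + h)) +
      covConst P θ γ Z * (lamCoeffInt (lagPoly p a) (lagPoly q b) d s (h - 1) +
        lamCoeffInt (lagPoly p a) (lagPoly q b) d s (-h - 1)) +
      if h = 0 then Var[fun x => Real.log (Z 0 x ^ 2); P] else 0 := by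
  have hv := fun t => (hX.log_vol_spec hd t).1
  rw [covariance_congr_ae (hX.log_sq_eq hZ t) (hX.log_sq_eq hZ (t + h)),
    covariance_add_left (hv t) (hlogZ t) ((hv (t + h)).add (hlogZ (t + h))),
    covariance_add_right (hv t) (hv (t + h)) (hlogZ (t + h)),
    covariance_add_right (hlogZ t) (hv (t + h)) (hlogZ (t + h)),
    hX.covariance_log_vol hd, hX.covariance_log_vol_log_innov hd hlogZ,
    covariance_comm (fun x => Real.log (Z t x ^ 2)) (fun x => Real.log (σ (t + h) x ^ 2)),
    hX.covariance_log_vol_log_innov hd hlogZ, hX.covariance_log_innov hlogZ,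
    show t - 1 - (t + h) = -h - 1 by ring, show t + h - 1 - t = h - 1 by ring]
  simp only [left_eq_add]
  ring

theorem IsSFIEGARCH.isSpectralDensity_log_sq (hX : IsSFIEGARCH P p q a b d s ω θ γ Z σ X)
    (hd : d < 1 / 2) (hZ : ∀ t, ∀ᵐ x ∂P, Z t x ≠ 0)
    (hlogZ : ∀ t, MemLp (fun x => Real.log (Z t x ^ 2)) 2 P) :
    IsSpectralDensity P (fun t x => Real.log (X t x ^ 2))
      (fun u => specLogVol (lagPoly p a) (lagPoly q b) d s (gVar P θ γ Z) u
        + covConst P θ γ Z / Real.pi * (Complex.exp (-(Complex.I * (u : ℂ))) *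
          transfer (lagPoly p a) (lagPoly q b) d s u).re
        + specLogInnov P Z u) where
  stationary :=
    { memLp := fun t => (memLp_congr_ae (hX.log_sq_eq hZ t)).mpr
        ((hX.log_vol_spec hd t).1.add (hlogZ t))
      mean_eq := fun t => by
        have hm : ∀ t, ∫ x, Real.log (X t x ^ 2) ∂P = ω + ∫ x, Real.log (Z 0 x ^ 2) ∂P := by
          intro t
          rw [integral_congr_ae (hX.log_sq_eq hZ t)]
          simp only [Pi.add_apply]
          rw [integral_add ((hX.log_vol_spec hd t).1.integrable (by norm_num))
            ((hlogZ t).integrable (by norm_num)), (hX.log_vol_spec hd t).2.1,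
            (hX.isSpectralDensity_log_innov hlogZ).stationary.mean_eq t]
        rw [hm, hm]
      cov_eq := fun t h => by
        rw [hX.covariance_log_sq hd hZ hlogZ, ← hX.covariance_log_sq hd hZ hlogZ 0 h, zero_add] }
  nonneg := fun u _ => by
    set w := Complex.exp (-(Complex.I * (u : ℂ))) *
      transfer (lagPoly p a) (lagPoly q b) d s u with hw
    -- The choice `a = Re w` matches the cross term exactly; replacing `(Re w)²` by `|w|² = |Λ|²`
    -- only increases the quadratic term.
    have h1 := quadratic_covariance_nonneg (hX.memLp_gProc 0) (hlogZ 0) w.re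
    have h2 : w.re ^ 2 ≤ ‖transfer (lagPoly p a) (lagPoly q b) d s u‖ ^ 2 := by
      have h3 := Complex.abs_re_le_norm w
      rw [hw, norm_mul, norm_exp_neg_I_mul, one_mul, ← hw] at h3
      exact sq_le_sq' (abs_le.mp h3).1 (abs_le.mp h3).2
    have h4 : 0 ≤ gVar P θ γ Z := variance_nonneg _ _
    have h5 := mul_le_mul_of_nonneg_left h2 h4
    have hpi := Real.pi_pos
    rw [specLogVol_eq, specLogInnov]
    have e : gVar P θ γ Z / (2 * Real.pi) *
          ‖transfer (lagPoly p a) (lagPoly q b) d s u‖ ^ 2 +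
        covConst P θ γ Z / Real.pi * w.re +
        Var[fun x => Real.log (Z 0 x ^ 2); P] / (2 * Real.pi) =
        (gVar P θ γ Z * ‖transfer (lagPoly p a) (lagPoly q b) d s u‖ ^ 2 +
          2 * w.re * covConst P θ γ Z + Var[fun x => Real.log (Z 0 x ^ 2); P]) /
          (2 * Real.pi) := by
      field_simp
    rw [e]
    refine div_nonneg ?_ (by positivity)
    rw [← gVar, ← covConst] at h1
    linarith
  even := fun u _ => by
    rw [specLogVol_neg, re_exp_mul_transfer_neg]
    rfl
  integrableOn :=
    ((integrableOn_specLogVol _ hX.period_pos hX.beta_ne_zero hd _).add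
      ((integrableOn_re_exp_mul_transfer _ hX.period_pos hX.beta_ne_zero hd).const_mul _)).add
      (integrable_const _)
  autocov_eq := fun h => by
    have i1 := integrableOn_exp_mul_ofReal (integrableOn_specLogVol (lagPoly p a) hX.period_pos
      hX.beta_ne_zero hd (gVar P θ γ Z)) h
    have i2 := (integrableOn_exp_mul_ofReal (integrableOn_re_exp_mul_transfer (lagPoly p a)
      hX.period_pos hX.beta_ne_zero hd) h).const_mul ((covConst P θ γ Z / Real.pi : ℝ) : ℂ)
    have i3 := integrableOn_exp_mul_ofReal
      (f := specLogInnov P Z) (hX.isSpectralDensity_log_innov hlogZ).integrableOn h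
    have e : ∀ u : ℝ, Complex.exp (Complex.I * (h : ℂ) * (u : ℂ)) *
        ((specLogVol (lagPoly p a) (lagPoly q b) d s (gVar P θ γ Z) u
          + covConst P θ γ Z / Real.pi * (Complex.exp (-(Complex.I * (u : ℂ))) *
            transfer (lagPoly p a) (lagPoly q b) d s u).re + specLogInnov P Z u : ℝ) : ℂ) =
        Complex.exp (Complex.I * (h : ℂ) * (u : ℂ)) *
          (specLogVol (lagPoly p a) (lagPoly q b) d s (gVar P θ γ Z) u : ℂ) +
        ((covConst P θ γ Z / Real.pi : ℝ) : ℂ) * (Complex.exp (Complex.I * (h : ℂ) * (u : ℂ)) *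
          ((Complex.exp (-(Complex.I * (u : ℂ))) *
            transfer (lagPoly p a) (lagPoly q b) d s u).re : ℂ)) +
        Complex.exp (Complex.I * (h : ℂ) * (u : ℂ)) * (specLogInnov P Z u : ℂ) := by
      intro u
      push_cast
      ring
    simp only [e]
    refine Eq.trans ?_ (integral_add (i1.add i2) i3).symm
    rw [integral_add' i1 i2, integral_const_mul,
      integral_exp_mul_specLogVol _ hX.period_pos hX.beta_ne_zero hd,
      integral_exp_mul_re_exp_mul_transfer _ hX.period_pos hX.beta_ne_zero hd]
    simp only [specLogInnov]
    rw [integral_exp_mul_const, ← zero_add h, hX.covariance_log_sq hd hZ hlogZ 0]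
    simp only [zero_add]
    have hpi : (Real.pi : ℂ) ≠ 0 := by exact_mod_cast Real.pi_ne_zero
    push_cast
    field_simp

end Model

end SFIEGARCH

end

/-- The random variable `ln(Z_t²)` is understood to be finite almost surely and to have a finite
variance; the first part is the hypothesis `hZ`.  The values of the densities at the finitely many
`u` with `e^{-isu} = 1`, where they are infinite if `d > 0`, are immaterial. -/
theorem mainTheorem9 {Ω : Type*} [MeasurableSpace Ω] (P : Measure Ω) [IsProbabilityMeasure P]
    (p q : ℕ) (a b : ℕ → ℝ) (d : ℝ) (s : ℕ) (ω θ γ : ℝ) (Z σ X : ℤ → Ω → ℝ)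
    (hX : SFIEGARCH.IsSFIEGARCH P p q a b d s ω θ γ Z σ X)
    (hd : d < 1 / 2)
    (hθγ : ¬ (θ = 0 ∧ γ = 0))
    (hα : ∀ z : ℂ, ‖z‖ ≤ 1 → Polynomial.aeval z (SFIEGARCH.lagPoly p a) ≠ 0)
    (hZ : ∀ t, ∀ᵐ x ∂P, Z t x ≠ 0)
    (hlogZ : ∀ t, MemLp (fun x => Real.log (Z t x ^ 2)) 2 P) :
    SFIEGARCH.IsSpectralDensity P (fun t x => Real.log (σ t x ^ 2))
      (SFIEGARCH.specLogVol (SFIEGARCH.lagPoly p a) (SFIEGARCH.lagPoly q b) d s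
        (SFIEGARCH.gVar P θ γ Z)) ∧
    SFIEGARCH.IsSpectralDensity P (fun t x => Real.log (Z t x ^ 2))
      (SFIEGARCH.specLogInnov P Z) ∧
    SFIEGARCH.IsSpectralDensity P (fun t x => Real.log (X t x ^ 2))
      (fun u =>
        SFIEGARCH.specLogVol (SFIEGARCH.lagPoly p a) (SFIEGARCH.lagPoly q b) d s
          (SFIEGARCH.gVar P θ γ Z) u
        + SFIEGARCH.covConst P θ γ Z / Real.pi *
          (Complex.exp (-(Complex.I * (u : ℂ))) *
            SFIEGARCH.transfer (SFIEGARCH.lagPoly p a) (SFIEGARCH.lagPoly q b) d s u).re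
        + SFIEGARCH.specLogInnov P Z u) := by
  exact ⟨hX.isSpectralDensity_log_vol hd, hX.isSpectralDensity_log_innov hlogZ,
    hX.isSpectralDensity_log_sq hd hZ hlogZ⟩
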